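/- Let $P(L)=P(L)(a,q)$ denote the normalized HOMFLY polynomial of an oriented link $L$ in $S^3$, determined by the skein relation $a\,P(L_+)-a^{-1}P(L_-)=(q-q^{-1})\,P(L_0)$ (where $L_+$, $L_-$, $L_0$ differ only at one crossing, which is positive, negative, respectively smoothed) together with $P(\mathrm{unknot})=1$. For coprime positive integers $m,n$ let $T_{m,n}$ be the torus knot with negative crossings, i.e. the closure of the braid $(\sigma_1^{-1}\sigma_2^{-1}\cdots\sigma_{n-1}^{-1})^m$ on $n$ strands, where $\sigma_i$ has a positive crossing. For $n\ge 1$ put $$\mathcal{P}_s(T_n)=\frac{\prod_{j=1}^{n-1}\bigl(1+a^2q^{2j}t^{2j+1}\bigr)}{\prod_{j=2}^{n}\bigl(1-q^{2j}t^{2j-2}\bigr)},$$ where the denominator is expanded as a series in positive powers of $q$ and $t$, so that this is a formal power series in $q$ whose coefficients are polynomials in $a$ and $t$. Lemma. For every $n\ge 1$, $$\mathcal{P}_s(T_n)\big|_{t=-1}=\lim_{m\to\infty}\,(qa^{-1})^{(m-1)(n-1)}\,P(T_{m,n})=\frac{1-q^2}{1-q^{2n}}\prod_{j=1}^{n-1}\frac{1-a^2q^{2j}}{1-q^{2j}}.$$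 Here $m$ runs through the positive integers coprime to $n$, rational functions of $q$ are expanded as formal Laurent series in $q$ at $q=0$ with coefficients in $\mathbb{Q}(a)$, and the limit is taken in the $q$-adic topology. -/

import Mathlib

open Filter Topology

/-! ### Braid groups -/

/-- Artin's relations among the generators `σ_0, …, σ_{k-1}` of the braid group on `k + 1` strands:
far commutativity and the braid relation. -/
inductive BraidRel (k : ℕ) : FreeGroup (Fin k) → Prop
  | comm (i j : Fin k) (h : (i : ℕ) + 1 < j) :
      BraidRel k (FreeGroup.of i * FreeGroup.of j * (FreeGroup.of j * FreeGroup.of i)⁻¹)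
  | braid (i j : Fin k) (h : (i : ℕ) + 1 = j) :
      BraidRel k (FreeGroup.of i * FreeGroup.of j * FreeGroup.of i *
        (FreeGroup.of j * FreeGroup.of i * FreeGroup.of j)⁻¹)

/-- The Artin braid group on `k + 1` strands (so `k` is the number of generators). -/
abbrev Braid (k : ℕ) : Type := PresentedGroup {r | BraidRel k r}

namespace Braid

/-- The elementary braid in which strands `i` and `i + 1` cross once, positively;
its inverse is the elementary braid with one negative crossing. -/
def σ {k : ℕ} (i : Fin k) : Braid k := PresentedGroup.of i

theorem σ_comm {k : ℕ} (i j : Fin k) (h : (i : ℕ) + 1 < j) : σ i * σ j = σ j * σ i :=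
  PresentedGroup.mk_eq_mk_of_mul_inv_mem (BraidRel.comm i j h)

theorem σ_braid {k : ℕ} (i j : Fin k) (h : (i : ℕ) + 1 = j) :
    σ i * σ j * σ i = σ j * σ i * σ j :=
  PresentedGroup.mk_eq_mk_of_mul_inv_mem (BraidRel.braid i j h)

/-- A map on generators that respects Artin's relations extends to the braid group. -/
def lift {k : ℕ} {G : Type*} [Group G] (f : Fin k → G)
    (hc : ∀ i j : Fin k, (i : ℕ) + 1 < j → f i * f j = f j * f i)
    (hb : ∀ i j : Fin k, (i : ℕ) + 1 = j → f i * f j * f i = f j * f i * f j) : Braid k →* G :=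
  PresentedGroup.toGroup (f := f) (by
    rintro r (⟨i, j, h⟩ | ⟨i, j, h⟩)
    · simp only [map_mul, map_inv, FreeGroup.lift_apply_of]
      rw [mul_inv_eq_one, hc i j h]
    · simp only [map_mul, map_inv, FreeGroup.lift_apply_of]
      rw [mul_inv_eq_one, hb i j h])

@[simp] theorem lift_σ {k : ℕ} {G : Type*} [Group G] (f : Fin k → G) (hc) (hb) (i : Fin k) :
    lift f hc hb (σ i) = f i :=
  PresentedGroup.toGroup.of _

theorem induction {k : ℕ} {C : Braid k → Prop} (one : C 1)
    (mul : ∀ i β, C β → C (σ i * β)) (inv : ∀ i β, C β → C ((σ i)⁻¹ * β)) (β : Braid k) : C β := by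
  have h : β ∈ Subgroup.closure (Set.range (σ (k := k))) := by
    have := PresentedGroup.closure_range_of {r | BraidRel k r}
    exact this ▸ Subgroup.mem_top β
  induction h using Subgroup.closure_induction_left with
  | one => exact one
  | mul_left x hx y _ ih => obtain ⟨i, rfl⟩ := hx; exact mul i y ih
  | inv_mul_cancel x hx y _ ih => obtain ⟨i, rfl⟩ := hx; exact inv i y ih

/-- The inclusion of braid groups that adds one more strand, uncrossed, at the end. -/
def addStrand (k : ℕ) : Braid k →* Braid (k + 1) :=
  lift (fun i => σ i.castSucc) (fun _ _ h => σ_comm _ _ h) (fun _ _ h => σ_braid _ _ h)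

@[simp] theorem addStrand_σ {k : ℕ} (i : Fin k) : addStrand k (σ i) = σ i.castSucc :=
  lift_σ _ _ _ _

end Braid

/-! ### Oriented links

By the theorems of Alexander and Markov, isotopy classes of nonempty oriented links in the
three-sphere are the same as braids up to Markov's moves, a braid standing for its closure. -/

/-- Markov's moves: conjugation, and positive and negative stabilization. -/
inductive MarkovMove : (Σ k, Braid k) → (Σ k, Braid k) → Prop
  | conj {k : ℕ} (α β : Braid k) : MarkovMove ⟨k, α * β⟩ ⟨k, β * α⟩
  | stab {k : ℕ} (β : Braid k) :
      MarkovMove ⟨k, β⟩ ⟨k + 1, Braid.addStrand k β * Braid.σ (Fin.last k)⟩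
  | stabInv {k : ℕ} (β : Braid k) :
      MarkovMove ⟨k, β⟩ ⟨k + 1, Braid.addStrand k β * (Braid.σ (Fin.last k))⁻¹⟩

/-- Nonempty oriented links up to isotopy: closed braids up to Markov equivalence. -/
def OrientedLink : Type := Quot MarkovMove

/-- The oriented link obtained by closing a braid. -/
def Braid.closure {k : ℕ} (β : Braid k) : OrientedLink := Quot.mk _ ⟨k, β⟩

/-- The unknot: the closure of the braid with one strand. -/
def unknot : OrientedLink := Braid.closure (1 : Braid 0)

/-- The negative torus link `T_{m,n}` (a knot if `m` and `n` are coprime), for `n ≥ 1`: the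
closure of the braid `(σ_1⁻¹ σ_2⁻¹ ⋯ σ_{n-1}⁻¹) ^ m` on `n` strands, all of whose crossings are
negative. -/
def torusLink (m n : ℕ) : OrientedLink :=
  Braid.closure ((List.ofFn fun i : Fin (n - 1) => (Braid.σ i)⁻¹).prod ^ m)

/-! ### The HOMFLY polynomial -/

/-- `P` is a normalized HOMFLY invariant with parameters `a` and `q`: it takes the value `1` at the
unknot and `a P(L₊) - a⁻¹ P(L₋) = (q - q⁻¹) P(L₀)` for three links that differ only at one crossing,
which is positive, negative, or smoothed. -/
def IsHOMFLY {K : Type*} [Field K] (a q : K) (P : OrientedLink → K) : Prop :=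
  P unknot = 1 ∧ ∀ (k : ℕ) (β : Braid k) (i : Fin k),
    a * P (β * Braid.σ i).closure - a⁻¹ * P (β * (Braid.σ i)⁻¹).closure =
      (q - q⁻¹) * P β.closure

/-! ### Existence and uniqueness of the HOMFLY polynomial -/

namespace HOMFLY

section Skein

variable {R A : Type*} [CommRing R] [AddCommGroup A] [Module R A]

/-- The two-sided skein relation for a function on a braid group. -/
def IsSkein (a z : Rˣ) {k : ℕ} (g : Braid k → A) : Prop :=
  ∀ (α β : Braid k) (i : Fin k),
    a • g (α * Braid.σ i * β) - a⁻¹ • g (α * (Braid.σ i)⁻¹ * β) = z • g (α * β)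

theorem IsSkein.left {a z : Rˣ} {k : ℕ} {g : Braid k → A} (hg : IsSkein a z g) (γ : Braid k) :
    IsSkein a z (fun β => g (γ * β)) := by
  intro α β i
  simpa [mul_assoc] using hg (γ * α) β i

theorem IsSkein.inv_mem {a z : Rˣ} {k : ℕ} {g : Braid k → A} (hg : IsSkein a z g)
    {W : Submodule R A} {α β : Braid k} {i : Fin k} (h1 : g (α * Braid.σ i * β) ∈ W)
    (h0 : g (α * β) ∈ W) : g (α * (Braid.σ i)⁻¹ * β) ∈ W := by
  have h : g (α * (Braid.σ i)⁻¹ * β) = a • (a • g (α * Braid.σ i * β) - z • g (α * β)) := by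
    rw [← hg α β i, sub_sub_cancel, smul_inv_smul]
  rw [h]
  exact W.smul_mem _ (W.sub_mem (W.smul_mem _ h1) (W.smul_mem _ h0))

theorem IsSkein.sq_mem {a z : Rˣ} {k : ℕ} {g : Braid k → A} (hg : IsSkein a z g)
    {W : Submodule R A} {α β : Braid k} {i : Fin k} (h1 : g (α * Braid.σ i * β) ∈ W)
    (h0 : g (α * β) ∈ W) : g (α * Braid.σ i * Braid.σ i * β) ∈ W := by
  have h : g (α * Braid.σ i * Braid.σ i * β) =
      a⁻¹ • (z • g (α * Braid.σ i * β) + a⁻¹ • g (α * β)) := by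
    have := hg (α * Braid.σ i) β i
    rw [mul_inv_cancel_right] at this
    rw [← this, sub_add_cancel, inv_smul_smul]
  rw [h]
  exact W.smul_mem _ (W.add_mem (W.smul_mem _ h1) (W.smul_mem _ h0))

theorem addStrand_comm_last {k : ℕ} (x : Braid k) :
    Commute (Braid.addStrand (k + 1) (Braid.addStrand k x)) (Braid.σ (Fin.last (k + 1))) := by
  induction x using Braid.induction with
  | one => simp
  | mul i β ih =>
    rw [map_mul, map_mul, Braid.addStrand_σ, Braid.addStrand_σ]
    exact Commute.mul_left (Braid.σ_comm _ _ (by simp)) ih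
  | inv i β ih =>
    rw [map_mul, map_mul, map_inv, map_inv, Braid.addStrand_σ, Braid.addStrand_σ]
    refine Commute.mul_left (Commute.inv_left ?_) ih
    exact Braid.σ_comm _ _ (by simp)

/-- The functions on `Braid (k + 1)` for which membership in `W` is to be shown. -/
structure Good (a z : Rˣ) (W : Submodule R A) {k : ℕ} (g : Braid (k + 1) → A) : Prop where
  skein : IsSkein a z g
  mem : ∀ x, g (Braid.addStrand k x) ∈ W
  mem_last : ∀ x y,
    g (Braid.addStrand k x * Braid.σ (Fin.last k) * Braid.addStrand k y) ∈ W

theorem Good.left {a z : Rˣ} {W : Submodule R A} {k : ℕ}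
    (key : ∀ g : Braid (k + 1) → A, Good a z W g → ∀ x y,
      g (Braid.σ (Fin.last k) * Braid.addStrand k x * Braid.σ (Fin.last k) *
        Braid.addStrand k y) ∈ W)
    {g : Braid (k + 1) → A} (hg : Good a z W g) (i : Fin (k + 1)) :
    Good a z W (fun β => g (Braid.σ i * β)) := by
  refine ⟨hg.skein.left _, fun x => ?_, fun x y => ?_⟩
  · induction i using Fin.lastCases with
    | last => simpa using hg.mem_last 1 x
    | cast i => simpa using hg.mem (Braid.σ i * x)
  · induction i using Fin.lastCases with
    | last => simpa [mul_assoc] using key g hg x y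
    | cast i => simpa [mul_assoc] using hg.mem_last (Braid.σ i * x) y

theorem Good.leftInv {a z : Rˣ} {W : Submodule R A} {k : ℕ} {g : Braid (k + 1) → A}
    (hg : Good a z W g) (i : Fin (k + 1)) (h : Good a z W (fun β => g (Braid.σ i * β))) :
    Good a z W (fun β => g ((Braid.σ i)⁻¹ * β)) := by
  refine ⟨hg.skein.left _, fun x => ?_, fun x y => ?_⟩
  · simpa using hg.skein.inv_mem (α := 1) (i := i) (by simpa using h.mem x)
      (by simpa using hg.mem x)
  · have := hg.skein.inv_mem (α := 1) (i := i) (by simpa using h.mem_last x y)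
      (by simpa using hg.mem_last x y)
    simpa using this

theorem Good.forall_mem {a z : Rˣ} {W : Submodule R A} {k : ℕ}
    (key : ∀ g : Braid (k + 1) → A, Good a z W g → ∀ x y,
      g (Braid.σ (Fin.last k) * Braid.addStrand k x * Braid.σ (Fin.last k) *
        Braid.addStrand k y) ∈ W)
    (β : Braid (k + 1)) : ∀ g : Braid (k + 1) → A, Good a z W g → g β⁻¹ ∈ W := by
  have main : ∀ β : Braid (k + 1), ∀ g : Braid (k + 1) → A, Good a z W g →
      Good a z W (fun γ => g (β * γ)) := by
    intro β
    induction β using Braid.induction with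
    | one => intro g hg; simpa using hg
    | mul i β ih =>
      intro g hg
      simpa [mul_assoc] using ih _ (hg.left key i)
    | inv i β ih =>
      intro g hg
      simpa [mul_assoc] using ih _ (hg.leftInv i (hg.left key i))
  intro g hg
  simpa using (main β⁻¹ g hg).mem 1

theorem Good.key {a z : Rˣ} {W : Submodule R A} : ∀ (k : ℕ) (g : Braid (k + 1) → A),
    Good a z W g → ∀ x y, g (Braid.σ (Fin.last k) * Braid.addStrand k x * Braid.σ (Fin.last k) *
        Braid.addStrand k y) ∈ W := by
  intro k
  induction k with
  | zero =>
    intro g hg x y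
    have hx : x = 1 := by
      induction x using Braid.induction with
      | one => rfl
      | mul i => exact i.elim0
      | inv i => exact i.elim0
    subst hx
    simpa using hg.skein.sq_mem (α := 1) (i := Fin.last 0) (by simpa using hg.mem_last 1 y)
      (by simpa using hg.mem y)
  | succ k ih =>
    intro g hg x y
    have hgood : Good a z W (fun x => g (Braid.σ (Fin.last (k + 1)) * Braid.addStrand (k + 1) x *
        Braid.σ (Fin.last (k + 1)) * Braid.addStrand (k + 1) y)) := by
      refine ⟨?_, fun x' => ?_, fun x' y' => ?_⟩
      · intro α β i
        have := hg.skein (Braid.σ (Fin.last (k + 1)) * Braid.addStrand (k + 1) α)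
          (Braid.addStrand (k + 1) β * Braid.σ (Fin.last (k + 1)) * Braid.addStrand (k + 1) y)
          i.castSucc
        simpa [mul_assoc] using this
      · have := hg.skein.sq_mem (α := Braid.addStrand (k + 1) (Braid.addStrand k x'))
          (β := Braid.addStrand (k + 1) y) (i := Fin.last (k + 1)) (hg.mem_last _ _)
          (by rw [← map_mul]; exact hg.mem _)
        rwa [(addStrand_comm_last x').eq] at this
      · have hb : Braid.σ (Fin.last (k + 1)) * Braid.σ (Fin.last k).castSucc *
            Braid.σ (Fin.last (k + 1)) = Braid.σ (Fin.last k).castSucc *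
            Braid.σ (Fin.last (k + 1)) * Braid.σ (Fin.last k).castSucc :=
          (Braid.σ_braid _ _ (by simp)).symm
        have := hg.mem_last (Braid.addStrand k x' * Braid.σ (Fin.last k))
          (Braid.σ (Fin.last k) * Braid.addStrand k y' * y)
        convert this using 2
        simp only [map_mul, Braid.addStrand_σ]
        have c1 := (addStrand_comm_last x').eq
        have c2 := (addStrand_comm_last y').eq
        generalize Braid.addStrand (k + 1) (Braid.addStrand k x') = X at *
        generalize Braid.addStrand (k + 1) (Braid.addStrand k y') = Y at *
        generalize Braid.σ (Fin.last (k + 1)) = s at *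
        generalize Braid.σ (Fin.last k).castSucc = t at *
        generalize Braid.addStrand (k + 1) y = Z
        calc s * (X * t * Y) * s * Z = (s * X) * t * (Y * s) * Z := by simp only [mul_assoc]
          _ = X * (s * t * s) * Y * Z := by rw [← c1, c2]; simp only [mul_assoc]
          _ = X * t * s * (t * Y * Z) := by rw [hb]; simp only [mul_assoc]
    simpa using Good.forall_mem ih x⁻¹ _ hgood

/-- A family of functions on the braid groups that satisfies the skein relation and is invariant
under Markov's moves takes its values in the submodule generated by its value at the unknot. -/
theorem mem_of_markov {a z : Rˣ} {W : Submodule R A} (f : ∀ k, Braid k → A)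
    (conj : ∀ k (α β : Braid k), f k (α * β) = f k (β * α))
    (stab : ∀ k (β : Braid k), f (k + 1) (Braid.addStrand k β * Braid.σ (Fin.last k)) = f k β)
    (stabInv : ∀ k (β : Braid k),
      f (k + 1) (Braid.addStrand k β * (Braid.σ (Fin.last k))⁻¹) = f k β)
    (skein : ∀ k (β : Braid k) (i : Fin k),
      a • f k (β * Braid.σ i) - a⁻¹ • f k (β * (Braid.σ i)⁻¹) = z • f k β)
    (h0 : f 0 1 ∈ W) (k : ℕ) : ∀ β, f k β ∈ W := by
  have hsk : ∀ k, IsSkein a z (f k) := by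
    intro k α β i
    rw [conj k _ β, conj k _ β, conj k _ β, ← mul_assoc, ← mul_assoc]
    exact skein k _ i
  induction k with
  | zero =>
    intro β
    have hx : β = 1 := by
      induction β using Braid.induction with
      | one => rfl
      | mul i => exact i.elim0
      | inv i => exact i.elim0
    rwa [hx]
  | succ k ih =>
    intro β
    have : Good a z W (f (k + 1)) := by
      refine ⟨hsk _, fun x => ?_, fun x y => ?_⟩
      · have h := skein (k + 1) (Braid.addStrand k x) (Fin.last k)
        rw [stab, stabInv] at h
        rw [← inv_smul_eq_iff.mpr h]
        exact W.smul_mem _ (W.sub_mem (W.smul_mem _ (ih x)) (W.smul_mem _ (ih x)))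
      · rw [conj, ← mul_assoc, ← map_mul, stab]
        exact ih _
    simpa using Good.forall_mem (Good.key k) β⁻¹ _ this

end Skein

end HOMFLY

namespace HOMFLY

section StateSum

variable {K : Type*} [Field K] (q : K)

/-- The diagonal part of the R-matrix of `sl(N)`. -/
def rdiag {N : ℕ} (x y : Fin N) : K := if x = y then q - 1 else if x < y then q - q⁻¹ else 0

/-- The R-matrix of `sl(N)` acting at the strands `i`, `i + 1`. -/
def rop {k N : ℕ} (i : Fin k) : Module.End K ((Fin (k + 1) → Fin N) → K) where
  toFun f c := f (c ∘ Equiv.swap i.castSucc i.succ) + rdiag q (c i.castSucc) (c i.succ) * f c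
  map_add' f g := by ext c; simp; ring
  map_smul' r f := by ext c; simp; ring

theorem rop_apply {k N : ℕ} (i : Fin k) (f : (Fin (k + 1) → Fin N) → K) (c) :
    rop q i f c = f (c ∘ Equiv.swap i.castSucc i.succ) +
      rdiag q (c i.castSucc) (c i.succ) * f c := rfl

theorem rop_sq {k N : ℕ} (hq : q ≠ 0) (i : Fin k) :
    rop (N := N) q i * rop q i = (q - q⁻¹) • rop q i + 1 := by
  refine LinearMap.ext fun f => funext fun c => ?_
  have hs : (c ∘ Equiv.swap i.castSucc i.succ) ∘ Equiv.swap i.castSucc i.succ = c := by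
    ext; simp
  simp only [Module.End.mul_apply, rop_apply, hs, LinearMap.add_apply, LinearMap.smul_apply,
    Module.End.one_apply, Pi.add_apply, Pi.smul_apply, smul_eq_mul]
  simp only [Function.comp_apply, Equiv.swap_apply_left, Equiv.swap_apply_right]
  rcases lt_trichotomy (c i.castSucc) (c i.succ) with h | h | h
  · simp [rdiag, h, h.ne, h.ne', h.not_gt]; ring
  · have : c ∘ Equiv.swap i.castSucc i.succ = c := by
      ext j
      by_cases h1 : j = i.castSucc
      · subst h1; simp [h]
      · by_cases h2 : j = i.succ
        · subst h2; simp [h]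
        · simp [Equiv.swap_apply_of_ne_of_ne h1 h2]
    rw [this]
    simp [rdiag, h]; field_simp; ring
  · simp [rdiag, h, h.ne, h.ne', h.not_gt]; ring

theorem rop_comm {k N : ℕ} (i j : Fin k) (h : (i : ℕ) + 1 < j) :
    rop (N := N) q i * rop q j = rop q j * rop q i := by
  refine LinearMap.ext fun f => funext fun c => ?_
  have h1 : j.castSucc ≠ i.castSucc := by simp [Fin.ext_iff]; omega
  have h2 : j.castSucc ≠ i.succ := by simp [Fin.ext_iff]; omega
  have h3 : j.succ ≠ i.castSucc := by simp [Fin.ext_iff]; omega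
  have h4 : j.succ ≠ i.succ := by simp [Fin.ext_iff]; omega
  have hs : (c ∘ Equiv.swap i.castSucc i.succ) ∘ Equiv.swap j.castSucc j.succ =
      (c ∘ Equiv.swap j.castSucc j.succ) ∘ Equiv.swap i.castSucc i.succ := by
    have hd : Equiv.Perm.Disjoint (Equiv.swap i.castSucc i.succ)
        (Equiv.swap j.castSucc j.succ) := by
      intro x
      by_cases hx : x = j.castSucc
      · left; subst hx; exact Equiv.swap_apply_of_ne_of_ne h1 h2
      · by_cases hy : x = j.succ
        · left; subst hy; exact Equiv.swap_apply_of_ne_of_ne h3 h4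
        · right; exact Equiv.swap_apply_of_ne_of_ne hx hy
    have := hd.commute.eq
    ext x
    have hx := congrArg (fun e => c (e x)) this
    simpa using congrArg Fin.val hx
  simp only [Module.End.mul_apply, rop_apply, hs]
  simp only [Function.comp_apply, Equiv.swap_apply_of_ne_of_ne h1 h2,
    Equiv.swap_apply_of_ne_of_ne h3 h4, Equiv.swap_apply_of_ne_of_ne h1.symm h3.symm,
    Equiv.swap_apply_of_ne_of_ne h2.symm h4.symm]
  ring

theorem yang_baxter {N : ℕ} (hq : q ≠ 0) (φ : Fin N → Fin N → Fin N → K) (x y z : Fin N) :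
    (φ z y x + rdiag q y z * φ y z x + rdiag q x z * (φ x y z + rdiag q y x * φ y x z)) +
      rdiag q x y * (φ z x y + rdiag q x z * φ x z y + rdiag q y z *
        (φ y x z + rdiag q x y * φ x y z)) =
    (φ z y x + rdiag q x y * φ z x y + rdiag q x z * (φ x y z + rdiag q z y * φ x z y)) +
      rdiag q y z * (φ y z x + rdiag q x z * φ y x z + rdiag q x y *
        (φ x z y + rdiag q y z * φ x y z)) := by
  rcases lt_trichotomy x y with h1 | h1 | h1 <;> rcases lt_trichotomy y z with h2 | h2 | h2 <;>
    rcases lt_trichotomy x z with h3 | h3 | h3 <;>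
    first
    | (exfalso; order)
    | (try subst h1
       try subst h2
       try subst h3
       simp [rdiag, *, ne_of_lt, ne_of_gt, not_lt_of_gt]
       try field_simp
       try ring)

theorem rop_braid {k N : ℕ} (hq : q ≠ 0) (i j : Fin k) (h : (i : ℕ) + 1 = j) :
    rop (N := N) q i * rop q j * rop q i = rop q j * rop q i * rop q j := by
  refine LinearMap.ext fun f => funext fun c => ?_
  obtain ⟨p0, hp0⟩ : ∃ p, p = i.castSucc := ⟨_, rfl⟩
  obtain ⟨p1, hp1⟩ : ∃ p, p = i.succ := ⟨_, rfl⟩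
  obtain ⟨p2, hp2⟩ : ∃ p, p = j.succ := ⟨_, rfl⟩
  have hp1' : p1 = j.castSucc := by rw [hp1]; ext; simpa using h
  have h01 : p0 ≠ p1 := by rw [hp0, hp1]; simp [Fin.ext_iff]
  have h12 : p1 ≠ p2 := by rw [hp1', hp2]; simp [Fin.ext_iff]
  have h02 : p0 ≠ p2 := by rw [hp0, hp2]; simp [Fin.ext_iff]; omega
  simp only [Module.End.mul_apply, rop_apply, ← hp0, ← hp1, ← hp2, ← hp1']
  have e1 : ∀ g : Fin (k + 1) → Fin N, (g ∘ Equiv.swap p0 p1) p0 = g p1 := by simp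
  have e2 : ∀ g : Fin (k + 1) → Fin N, (g ∘ Equiv.swap p0 p1) p1 = g p0 := by simp
  have e3 : ∀ g : Fin (k + 1) → Fin N, (g ∘ Equiv.swap p0 p1) p2 = g p2 := fun g => by
    simp [Equiv.swap_apply_of_ne_of_ne h02.symm h12.symm]
  have e4 : ∀ g : Fin (k + 1) → Fin N, (g ∘ Equiv.swap p1 p2) p0 = g p0 := fun g => by
    simp [Equiv.swap_apply_of_ne_of_ne h01 h02]
  have e5 : ∀ g : Fin (k + 1) → Fin N, (g ∘ Equiv.swap p1 p2) p1 = g p2 := by simp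
  have e6 : ∀ g : Fin (k + 1) → Fin N, (g ∘ Equiv.swap p1 p2) p2 = g p1 := by simp
  let d : Fin N → Fin N → Fin N → (Fin (k + 1) → Fin N) := fun u v w r =>
    if r = p0 then u else if r = p1 then v else if r = p2 then w else c r
  have hd : ∀ g : Fin (k + 1) → Fin N, (∀ r, r ≠ p0 → r ≠ p1 → r ≠ p2 → g r = c r) →
      g = d (g p0) (g p1) (g p2) := by
    intro g hg
    funext r
    simp only [d]
    split_ifs with h1 h2 h3
    · rw [h1]
    · rw [h2]
    · rw [h3]
    · exact hg r h1 h2 h3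
  have hc : ∀ g : Fin (k + 1) → Fin N, (∀ r, r ≠ p0 → r ≠ p1 → r ≠ p2 → g r = c r) →
      f g = f (d (g p0) (g p1) (g p2)) := fun g hg => congrArg f (hd g hg)
  have o1 : ∀ r, r ≠ p0 → r ≠ p1 → Equiv.swap p0 p1 r = r :=
    fun r a b => Equiv.swap_apply_of_ne_of_ne a b
  have o2 : ∀ r, r ≠ p1 → r ≠ p2 → Equiv.swap p1 p2 r = r :=
    fun r a b => Equiv.swap_apply_of_ne_of_ne a b
  have yb := yang_baxter q hq (fun u v w => f (d u v w)) (c p0) (c p1) (c p2)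
  have s1 : ∀ g : Fin (k + 1) → Fin N, (g ∘ Equiv.swap p0 p1) ∘ Equiv.swap p0 p1 = g :=
    fun g => by funext r; simp
  have s2 : ∀ g : Fin (k + 1) → Fin N, (g ∘ Equiv.swap p1 p2) ∘ Equiv.swap p1 p2 = g :=
    fun g => by funext r; simp
  simp only [s1, s2, e1, e2, e3, e4, e5, e6]
  rw [hc c (fun _ _ _ _ => rfl),
    hc (c ∘ Equiv.swap p0 p1) (fun r a b e => by simp [o1 r a b]),
    hc (c ∘ Equiv.swap p1 p2) (fun r a b e => by simp [o2 r b e]),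
    hc ((c ∘ Equiv.swap p0 p1) ∘ Equiv.swap p1 p2) (fun r a b e => by simp [o1 r a b, o2 r b e]),
    hc ((c ∘ Equiv.swap p1 p2) ∘ Equiv.swap p0 p1) (fun r a b e => by simp [o1 r a b, o2 r b e]),
    hc (((c ∘ Equiv.swap p0 p1) ∘ Equiv.swap p1 p2) ∘ Equiv.swap p0 p1)
      (fun r a b e => by simp [o1 r a b, o2 r b e]),
    hc (((c ∘ Equiv.swap p1 p2) ∘ Equiv.swap p0 p1) ∘ Equiv.swap p1 p2)
      (fun r a b e => by simp [o1 r a b, o2 r b e])]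
  simp only [e1, e2, e3, e4, e5, e6]
  linear_combination yb

/-- The invertible R-matrix, multiplied by `q ^ (-N)`. -/
def runit {k N : ℕ} (hq : q ≠ 0) (i : Fin k) :
    (Module.End K ((Fin (k + 1) → Fin N) → K))ˣ where
  val := (q ^ N)⁻¹ • rop q i
  inv := q ^ N • (rop q i - (q - q⁻¹) • 1)
  val_inv := by
    rw [smul_mul_smul_comm, inv_mul_cancel₀ (pow_ne_zero _ hq), one_smul, mul_sub, rop_sq q hq]
    simp
  inv_val := by
    rw [smul_mul_smul_comm, mul_inv_cancel₀ (pow_ne_zero _ hq), one_smul, sub_mul, rop_sq q hq]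
    simp

/-- The representation of the braid group by R-matrices. -/
def rep (k N : ℕ) (hq : q ≠ 0) : Braid k →* (Module.End K ((Fin (k + 1) → Fin N) → K))ˣ :=
  Braid.lift (runit q hq)
    (fun i j h => by
      ext1
      simp only [Units.val_mul, runit, smul_mul_smul_comm, rop_comm q i j h])
    (fun i j h => by
      ext1
      simp only [Units.val_mul, runit, smul_mul_smul_comm, rop_braid q hq i j h])

/-- The weight of a color. -/
def weight {N : ℕ} (x : Fin N) : K := q ^ (2 * (x : ℤ) + 1 - N)

/-- The diagonal operator given by the weights of the colors. -/
def wop (k N : ℕ) : Module.End K ((Fin (k + 1) → Fin N) → K) where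
  toFun f c := (∏ j, weight q (c j)) * f c
  map_add' f g := by ext c; simp; ring
  map_smul' r f := by ext c; simp; ring

theorem wop_apply {k N : ℕ} (f : (Fin (k + 1) → Fin N) → K) (c) :
    wop q k N f c = (∏ j, weight q (c j)) * f c := rfl

theorem wop_rop {k N : ℕ} (i : Fin k) : Commute (wop q k N) (rop q i) := by
  refine LinearMap.ext fun f => funext fun c => ?_
  simp only [Module.End.mul_apply, rop_apply, wop_apply]
  have : ∏ j, weight q ((c ∘ Equiv.swap i.castSucc i.succ) j) = ∏ j, weight q (c j) :=
    Equiv.prod_comp (Equiv.swap i.castSucc i.succ) (fun j => weight q (c j))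
  rw [this]; ring

theorem wop_rep {k N : ℕ} (hq : q ≠ 0) (β : Braid k) :
    Commute (wop q k N) (rep q k N hq β : Module.End K ((Fin (k + 1) → Fin N) → K)) := by
  have h : ∀ i : Fin k, Commute (wop q k N)
      (rep q k N hq (Braid.σ i) : Module.End K ((Fin (k + 1) → Fin N) → K)) := by
    intro i
    rw [rep, Braid.lift_σ]
    exact (wop_rop q i).smul_right _
  induction β using Braid.induction with
  | one => simp
  | mul i β ih => rw [map_mul, Units.val_mul]; exact (h i).mul_right ih
  | inv i β ih =>
    rw [map_mul, Units.val_mul, map_inv]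
    exact (Commute.units_inv_right (h i)).mul_right ih

/-- The `sl(N)` invariant of a closed braid, as a weighted trace. -/
noncomputable def slN (k N : ℕ) (hq : q ≠ 0) (β : Braid k) : K :=
  LinearMap.trace K ((Fin (k + 1) → Fin N) → K) (wop q k N * (rep q k N hq β).val)

theorem trace_apply {ι : Type*} [Fintype ι] [DecidableEq ι] (A : Module.End K (ι → K)) :
    LinearMap.trace K (ι → K) A = ∑ c, A (Pi.single c 1) c := by
  rw [LinearMap.trace_eq_matrix_trace K (Pi.basisFun K ι)]
  simp [Matrix.trace]

theorem slN_conj {k N : ℕ} (hq : q ≠ 0) (α β : Braid k) :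
    slN q k N hq (α * β) = slN q k N hq (β * α) := by
  rw [slN, slN, map_mul (rep q k N hq), map_mul (rep q k N hq), Units.val_mul, Units.val_mul,
    ← mul_assoc, (wop_rep q hq α).eq, mul_assoc, LinearMap.trace_mul_comm, mul_assoc]

theorem rep_σ {k N : ℕ} (hq : q ≠ 0) (i : Fin k) :
    (rep q k N hq (Braid.σ i)).val = (q ^ N)⁻¹ • rop q i := by
  rw [rep, Braid.lift_σ]; rfl

theorem rep_σ_inv {k N : ℕ} (hq : q ≠ 0) (i : Fin k) :
    (rep q k N hq (Braid.σ i)⁻¹).val = q ^ N • (rop q i - (q - q⁻¹) • 1) := by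
  rw [rep, map_inv, Braid.lift_σ]; rfl

theorem slN_skein {k N : ℕ} (hq : q ≠ 0) (β : Braid k) (i : Fin k) :
    q ^ N * slN q k N hq (β * Braid.σ i) - (q ^ N)⁻¹ * slN q k N hq (β * (Braid.σ i)⁻¹) =
      (q - q⁻¹) * slN q k N hq β := by
  have hN : q ^ N ≠ 0 := pow_ne_zero _ hq
  rw [slN, slN, slN, map_mul (rep q k N hq), map_mul (rep q k N hq), Units.val_mul, Units.val_mul,
    rep_σ, rep_σ_inv]
  simp only [mul_smul_comm, map_smul, mul_sub, map_sub, mul_one, smul_eq_mul]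
  field_simp
  ring

/-- Fixing the color of the last strand. -/
def res {k N : ℕ} (x : Fin N) :
    ((Fin (k + 2) → Fin N) → K) →ₗ[K] ((Fin (k + 1) → Fin N) → K) where
  toFun f c := f (Fin.snoc (α := fun _ => Fin N) c x)
  map_add' _ _ := rfl
  map_smul' _ _ := rfl

theorem snoc_swap {k N : ℕ} (c : Fin (k + 1) → Fin N) (x : Fin N) (i : Fin k) :
    (Fin.snoc (α := fun _ => Fin N) c x : Fin (k + 2) → Fin N) ∘
      Equiv.swap i.castSucc.castSucc i.castSucc.succ =
    Fin.snoc (α := fun _ => Fin N) (c ∘ Equiv.swap i.castSucc i.succ) x := by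
  funext j
  induction j using Fin.lastCases with
  | last =>
    rw [Function.comp_apply, Equiv.swap_apply_of_ne_of_ne, Fin.snoc_last, Fin.snoc_last]
    · simp [Fin.ext_iff]; omega
    · simp [Fin.ext_iff]; omega
  | cast j =>
    rw [Function.comp_apply, Fin.snoc_castSucc, Fin.succ_castSucc,
      (Fin.castSucc_injective _).swap_apply, Fin.snoc_castSucc, Function.comp_apply]

theorem res_rop {k N : ℕ} (x : Fin N) (i : Fin k) (f : (Fin (k + 2) → Fin N) → K) :
    res x (rop q i.castSucc f) = rop q i (res x f) := by
  funext c
  change rop q i.castSucc f (Fin.snoc (α := fun _ => Fin N) c x) = _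
  rw [rop_apply, rop_apply, snoc_swap, Fin.succ_castSucc, Fin.snoc_castSucc, Fin.snoc_castSucc]
  rfl

theorem res_rep {k N : ℕ} (hq : q ≠ 0) (x : Fin N) (β : Braid k) :
    ∀ f : (Fin (k + 2) → Fin N) → K,
      res x ((rep q (k + 1) N hq (Braid.addStrand k β)).val f) =
        (rep q k N hq β).val (res x f) := by
  induction β using Braid.induction with
  | one => intro f; simp
  | mul i β ih =>
    intro f
    simp only [map_mul, Units.val_mul, Module.End.mul_apply, Braid.addStrand_σ, rep_σ,
      LinearMap.smul_apply, map_smul, res_rop, ih]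
  | inv i β ih =>
    intro f
    simp only [map_mul, map_inv (Braid.addStrand k), Units.val_mul, Module.End.mul_apply,
      Braid.addStrand_σ, rep_σ_inv, LinearMap.smul_apply, map_smul, LinearMap.sub_apply, map_sub,
      Module.End.one_apply, res_rop, ih]

theorem sum_snoc {k N : ℕ} (F : (Fin (k + 2) → Fin N) → K) :
    ∑ c, F c = ∑ c : Fin (k + 1) → Fin N, ∑ x, F (Fin.snoc (α := fun _ => Fin N) c x) := by
  rw [← Fintype.sum_prod_type', ← (Fin.snocEquiv (fun _ : Fin (k + 2) => Fin N)).sum_comp,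
    ← (Equiv.prodComm _ _).sum_comp]
  rfl

theorem res_single {k N : ℕ} (c : Fin (k + 1) → Fin N) (x : Fin N) :
    res x (Pi.single (Fin.snoc (α := fun _ => Fin N) c x) (1 : K)) = Pi.single c 1 := by
  funext d
  change Pi.single (M := fun _ => K) (Fin.snoc (α := fun _ => Fin N) c x) 1 (Fin.snoc d x) = _
  by_cases h : d = c
  · subst h; simp
  · rw [Pi.single_eq_of_ne h, Pi.single_eq_of_ne]
    intro h'
    exact h (Fin.snoc_injective2 h').1

theorem res_rop_single {k N : ℕ} (c : Fin (k + 1) → Fin N) (x : Fin N) :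
    res x (rop q (Fin.last k) (Pi.single (Fin.snoc (α := fun _ => Fin N) c x) (1 : K))) =
      ((if c (Fin.last k) = x then 1 else 0) + rdiag q (c (Fin.last k)) x) •
        Pi.single c (1 : K) := by
  funext d
  change rop q (Fin.last k) _ (Fin.snoc (α := fun _ => Fin N) d x) = _
  rw [rop_apply]
  have hl : (Fin.last k).succ = Fin.last (k + 1) := rfl
  rw [hl, Fin.snoc_castSucc, Fin.snoc_last]
  have h2 := congrFun (res_single (K := K) c x) d
  change Pi.single (M := fun _ => K) (Fin.snoc (α := fun _ => Fin N) c x) 1 (Fin.snoc d x) = _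
    at h2
  rw [h2]
  by_cases hd : d (Fin.last k) = x
  · have hsw : (Fin.snoc (α := fun _ => Fin N) d x : Fin (k + 2) → Fin N) ∘
        Equiv.swap (Fin.last k).castSucc (Fin.last (k + 1)) = Fin.snoc d x := by
      funext j
      by_cases h3 : j = (Fin.last k).castSucc
      · subst h3
        rw [Function.comp_apply, Equiv.swap_apply_left, Fin.snoc_last, Fin.snoc_castSucc, hd]
      · by_cases h4 : j = Fin.last (k + 1)
        · subst h4
          rw [Function.comp_apply, Equiv.swap_apply_right, Fin.snoc_last, Fin.snoc_castSucc, hd]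
        · rw [Function.comp_apply, Equiv.swap_apply_of_ne_of_ne h3 h4]
    rw [hsw, h2]
    by_cases h : d = c
    · subst h; simp [hd]
    · simp [Pi.single_eq_of_ne h]
  · rw [Pi.single_eq_of_ne]
    · by_cases h : d = c
      · subst h; simp [hd]
      · simp [Pi.single_eq_of_ne h]
    · intro h'
      have := congrFun h' (Fin.last (k + 1))
      rw [Function.comp_apply, Equiv.swap_apply_right, Fin.snoc_last, Fin.snoc_castSucc] at this
      exact hd this

theorem sum_weight_rdiag {N : ℕ} (hq : q ≠ 0) (y : Fin N) :
    ∑ x : Fin N, weight q x * ((if y = x then 1 else 0) + rdiag q y x) = q ^ N := by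
  have h : ∀ M : ℕ, ∑ x ∈ Finset.range M, q ^ (2 * (x : ℤ) + 1 - N) *
      (if (y : ℕ) = x then q else if (y : ℕ) < x then q - q⁻¹ else 0) =
      if (y : ℕ) < M then q ^ (2 * (M : ℤ) - N) else 0 := by
    intro M
    induction M with
    | zero => simp
    | succ M ih =>
      rw [Finset.sum_range_succ, ih]
      have e1 : q ^ (2 * (M : ℤ) + 1 - N) = q ^ (2 * (M : ℤ) - N) * q := by
        rw [← zpow_add_one₀ hq]; congr 1; ring
      have e2 : q ^ (2 * ((M + 1 : ℕ) : ℤ) - N) = q ^ (2 * (M : ℤ) - N) * q * q := by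
        rw [← zpow_add_one₀ hq, ← zpow_add_one₀ hq]; congr 1; push_cast; ring
      rw [e1, e2]
      rcases lt_trichotomy (y : ℕ) M with h | h | h
      · simp only [h, h.ne, Nat.lt_succ_of_lt h, if_true, if_false]
        field_simp; ring
      · simp [h]
      · have h' : ¬ (y : ℕ) < M + 1 := by omega
        simp only [h.ne', h.not_gt, h', if_false]; ring
  have h2 := h N
  rw [if_pos y.2, Finset.sum_range] at h2
  have e3 : (2 * (N : ℤ) - N) = N := by ring
  rw [e3, zpow_natCast] at h2
  rw [← h2]
  refine Finset.sum_congr rfl fun x _ => ?_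
  rw [weight, rdiag]
  congr 1
  rcases eq_or_ne y x with e | e
  · simp [e]
  · simp [e, Fin.val_injective.ne e]

theorem sum_weight {N : ℕ} (hq : q ≠ 0) :
    (q - q⁻¹) * ∑ x : Fin N, weight q x = q ^ N - (q ^ N)⁻¹ := by
  have h : ∀ M : ℕ, (q - q⁻¹) * ∑ x ∈ Finset.range M, q ^ (2 * (x : ℤ) + 1 - N) =
      q ^ (2 * (M : ℤ) - N) - q ^ (-(N : ℤ)) := by
    intro M
    induction M with
    | zero => simp
    | succ M ih =>
      rw [Finset.sum_range_succ, mul_add, ih]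
      have e1 : q ^ (2 * (M : ℤ) + 1 - N) = q ^ (2 * (M : ℤ) - N) * q := by
        rw [← zpow_add_one₀ hq]; congr 1; ring
      have e2 : q ^ (2 * ((M + 1 : ℕ) : ℤ) - N) = q ^ (2 * (M : ℤ) - N) * q * q := by
        rw [← zpow_add_one₀ hq, ← zpow_add_one₀ hq]; congr 1; push_cast; ring
      rw [e1, e2]
      field_simp; ring
  have h2 := h N
  have e3 : (2 * (N : ℤ) - N) = N := by ring
  rw [Finset.sum_range, e3, zpow_natCast, zpow_neg, zpow_natCast] at h2
  exact h2

theorem slN_eq {k N : ℕ} (hq : q ≠ 0) (β : Braid k) :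
    slN q k N hq β =
      ∑ c, (∏ j, weight q (c j)) * (rep q k N hq β).val (Pi.single c 1) c := by
  rw [slN, trace_apply]; rfl

theorem prod_snoc {k N : ℕ} (c : Fin (k + 1) → Fin N) (x : Fin N) :
    ∏ j, weight q (Fin.snoc (α := fun _ => Fin N) c x j) =
      (∏ j, weight q (c j)) * weight q x := by
  rw [Fin.prod_univ_castSucc, Fin.snoc_last]
  simp only [Fin.snoc_castSucc]

theorem slN_stab {k N : ℕ} (hq : q ≠ 0) (β : Braid k) :
    slN q (k + 1) N hq (Braid.addStrand k β * Braid.σ (Fin.last k)) = slN q k N hq β := by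
  rw [slN_eq, slN_eq, sum_snoc]
  refine Finset.sum_congr rfl fun c _ => ?_
  have h : ∀ x : Fin N, (rep q (k + 1) N hq (Braid.addStrand k β * Braid.σ (Fin.last k))).val
      (Pi.single (Fin.snoc (α := fun _ => Fin N) c x) 1) (Fin.snoc (α := fun _ => Fin N) c x) =
      (q ^ N)⁻¹ * ((if c (Fin.last k) = x then 1 else 0) + rdiag q (c (Fin.last k)) x) *
        (rep q k N hq β).val (Pi.single c 1) c := by
    intro x
    have := congrFun (res_rep q hq x β ((rep q (k + 1) N hq (Braid.σ (Fin.last k))).val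
      (Pi.single (Fin.snoc (α := fun _ => Fin N) c x) 1))) c
    rw [map_mul, Units.val_mul, Module.End.mul_apply]
    refine this.trans ?_
    rw [rep_σ, LinearMap.smul_apply, map_smul, res_rop_single, map_smul, map_smul]
    simp only [Pi.smul_apply, smul_eq_mul, mul_assoc]
  simp only [h, prod_snoc]
  have hN : q ^ N ≠ 0 := pow_ne_zero _ hq
  calc _ = (∏ j, weight q (c j)) * (q ^ N)⁻¹ * (rep q k N hq β).val (Pi.single c 1) c *
        ∑ x : Fin N, weight q x *
          ((if c (Fin.last k) = x then 1 else 0) + rdiag q (c (Fin.last k)) x) := by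
        rw [Finset.mul_sum]
        exact Finset.sum_congr rfl fun x _ => by ring
    _ = _ := by
        rw [sum_weight_rdiag q hq]
        field_simp

theorem slN_addStrand {k N : ℕ} (hq : q ≠ 0) (β : Braid k) :
    slN q (k + 1) N hq (Braid.addStrand k β) = (∑ x : Fin N, weight q x) * slN q k N hq β := by
  rw [slN_eq, slN_eq, sum_snoc, Finset.mul_sum]
  refine Finset.sum_congr rfl fun c _ => ?_
  have h : ∀ x : Fin N, (rep q (k + 1) N hq (Braid.addStrand k β)).val
      (Pi.single (Fin.snoc (α := fun _ => Fin N) c x) 1) (Fin.snoc (α := fun _ => Fin N) c x) =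
        (rep q k N hq β).val (Pi.single c 1) c := by
    intro x
    have := congrFun (res_rep q hq x β (Pi.single (Fin.snoc (α := fun _ => Fin N) c x) 1)) c
    refine this.trans ?_
    rw [res_single]
  simp only [h, prod_snoc]
  rw [Finset.sum_mul]
  exact Finset.sum_congr rfl fun x _ => by ring

theorem slN_stabInv {k N : ℕ} (hq : q ≠ 0) (β : Braid k) :
    slN q (k + 1) N hq (Braid.addStrand k β * (Braid.σ (Fin.last k))⁻¹) = slN q k N hq β := by
  have h := slN_skein (N := N) q hq (Braid.addStrand k β) (Fin.last k)
  rw [slN_stab, slN_addStrand, ← mul_assoc, sum_weight q hq] at h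
  have hN : (q ^ N)⁻¹ ≠ 0 := inv_ne_zero (pow_ne_zero _ hq)
  refine mul_left_cancel₀ hN ?_
  linear_combination -h

theorem slN_unknot {N : ℕ} (hq : q ≠ 0) :
    (q - q⁻¹) * slN q 0 N hq 1 = q ^ N - (q ^ N)⁻¹ := by
  rw [← sum_weight q hq, slN_eq, map_one]
  congr 1
  refine Fintype.sum_equiv (Equiv.funUnique (Fin 1) (Fin N)) _ _ fun c => ?_
  simp

end StateSum

section Interpolation

open LaurentPolynomial

variable {K : Type*} [Field K] {q : K}

/-- The evaluation of a Laurent polynomial at all the powers of `q`. -/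
noncomputable def evalPow (hq : q ≠ 0) : K[T;T⁻¹] →+* (ℕ → K) :=
  RingHom.pi fun N => LaurentPolynomial.eval₂ (RingHom.id K) (Units.mk0 q hq ^ N)

theorem evalPow_apply (hq : q ≠ 0) (G : K[T;T⁻¹]) (N : ℕ) :
    evalPow hq G N = LaurentPolynomial.eval₂ (RingHom.id K) (Units.mk0 q hq ^ N) G := rfl

theorem evalPow_injective (hq : q ≠ 0) (hinj : Function.Injective fun N : ℕ => q ^ N) :
    Function.Injective (evalPow hq) := by
  rw [injective_iff_map_eq_zero]
  intro G hG
  obtain ⟨n, p, hp⟩ := G.exists_T_pow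
  have hp0 : p = 0 := by
    refine Polynomial.eq_zero_of_infinite_isRoot p
      ((Set.infinite_range_of_injective hinj).mono ?_)
    rintro _ ⟨N, rfl⟩
    have h := congrArg (fun G => evalPow hq G N) hp
    simp only [map_mul, hG, zero_mul, Pi.zero_apply] at h
    rw [evalPow_apply, eval₂_toLaurent] at h
    simpa [Polynomial.IsRoot.def, Polynomial.eval₂_id] using h
  rw [hp0, map_zero] at hp
  exact (isUnit_T (R := K) n).mul_left_eq_zero.mp hp.symm

theorem exists_interpolation (hq : q ≠ 0) (hq2 : q - q⁻¹ ≠ 0) (k : ℕ) (β : Braid k) :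
    ∃ G : K[T;T⁻¹], evalPow hq G = fun N => slN q k N hq β := by
  let _ : Module K[T;T⁻¹] (ℕ → K) := Module.compHom _ (evalPow hq)
  have hsmul : ∀ (G : K[T;T⁻¹]) (f : ℕ → K), G • f = evalPow hq G * f := fun _ _ => rfl
  let a : K[T;T⁻¹]ˣ := ⟨T 1, T (-1), by rw [← T_add, add_neg_cancel, T_zero],
    by rw [← T_add, neg_add_cancel, T_zero]⟩
  let z : K[T;T⁻¹]ˣ := Units.map (C : K →+* K[T;T⁻¹]) (Units.mk0 _ hq2)
  have ha : ∀ f : ℕ → K, a • f = fun N => q ^ N * f N := by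
    intro f; funext N
    change evalPow hq (T 1) N * f N = _
    rw [evalPow_apply, eval₂_T]; simp
  have ha' : ∀ f : ℕ → K, a⁻¹ • f = fun N => (q ^ N)⁻¹ * f N := by
    intro f; funext N
    change evalPow hq (T (-1)) N * f N = _
    rw [evalPow_apply, eval₂_T]; simp
  have hz : ∀ f : ℕ → K, z • f = fun N => (q - q⁻¹) * f N := by
    intro f; funext N
    change evalPow hq (C (q - q⁻¹)) N * f N = _
    rw [evalPow_apply, eval₂_C]; simp
  have := mem_of_markov (a := a) (z := z)
    (W := Submodule.span K[T;T⁻¹] {(1 : ℕ → K)}) (fun k β N => slN q k N hq β)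
    (fun k α β => funext fun N => slN_conj q hq α β)
    (fun k β => funext fun N => slN_stab q hq β)
    (fun k β => funext fun N => slN_stabInv q hq β)
    (fun k β i => by
      rw [ha, ha', hz]
      exact funext fun N => slN_skein q hq β i)
    (by
      rw [Submodule.mem_span_singleton]
      refine ⟨C (q - q⁻¹)⁻¹ * (T 1 - T (-1)), funext fun N => ?_⟩
      rw [hsmul, mul_one, evalPow_apply, map_mul, map_sub, eval₂_T, eval₂_T, eval₂_C]
      refine mul_left_cancel₀ hq2 ?_
      rw [slN_unknot]
      simp [hq2]) k β
  obtain ⟨G, hG⟩ := Submodule.mem_span_singleton.mp this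
  exact ⟨G, by rw [← hG, hsmul, mul_one]⟩

end Interpolation

theorem sub_inv_ne_zero {K : Type*} [Field K] {q : K} (hq : q ≠ 0)
    (hinj : Function.Injective fun N : ℕ => q ^ N) : q - q⁻¹ ≠ 0 := by
  intro h
  have h2 : q ^ 2 = q ^ 0 := by
    have := congrArg (q * ·) h
    simp only [mul_sub, mul_inv_cancel₀ hq, mul_zero] at this
    linear_combination this
  exact absurd (hinj h2) (by norm_num)

theorem exists_isHOMFLY {K : Type*} [Field K] {a q : K} (ha : a ≠ 0) (ha2 : a - a⁻¹ ≠ 0)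
    (hq : q ≠ 0) (hinj : Function.Injective fun N : ℕ => q ^ N) : ∃ P, IsHOMFLY a q P := by
  have hq2 := sub_inv_ne_zero hq hinj
  have inj := evalPow_injective hq hinj
  choose G hG using exists_interpolation hq hq2
  have hG' : ∀ k (β : Braid k) N, evalPow hq (G k β) N = slN q k N hq β :=
    fun k β N => congrFun (hG k β) N
  have conj : ∀ k (α β : Braid k), G k (α * β) = G k (β * α) := fun k α β =>
    inj (funext fun N => by rw [hG', hG', slN_conj])
  have stab : ∀ k (β : Braid k),
      G (k + 1) (Braid.addStrand k β * Braid.σ (Fin.last k)) = G k β := fun k β =>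
    inj (funext fun N => by rw [hG', hG', slN_stab])
  have stabInv : ∀ k (β : Braid k),
      G (k + 1) (Braid.addStrand k β * (Braid.σ (Fin.last k))⁻¹) = G k β := fun k β =>
    inj (funext fun N => by rw [hG', hG', slN_stabInv])
  have skein : ∀ k (β : Braid k) (i : Fin k),
      LaurentPolynomial.T 1 * G k (β * Braid.σ i) -
        LaurentPolynomial.T (-1) * G k (β * (Braid.σ i)⁻¹) =
      LaurentPolynomial.C (q - q⁻¹) * G k β := fun k β i =>
    inj (funext fun N => by
      rw [map_sub, map_mul, map_mul, map_mul, Pi.sub_apply, Pi.mul_apply, Pi.mul_apply,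
        Pi.mul_apply, hG', hG', hG', evalPow_apply, evalPow_apply, evalPow_apply,
        LaurentPolynomial.eval₂_T, LaurentPolynomial.eval₂_T, LaurentPolynomial.eval₂_C]
      simpa using slN_skein (N := N) q hq β i)
  have unknot_eq : LaurentPolynomial.C (q - q⁻¹) * G 0 1 =
      LaurentPolynomial.T 1 - LaurentPolynomial.T (-1) :=
    inj (funext fun N => by
      rw [map_mul, map_sub (evalPow hq), Pi.sub_apply, Pi.mul_apply, hG', evalPow_apply,
        evalPow_apply, evalPow_apply, LaurentPolynomial.eval₂_T, LaurentPolynomial.eval₂_T,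
        LaurentPolynomial.eval₂_C]
      simpa using slN_unknot (N := N) q hq)
  let ev : LaurentPolynomial K →+* K :=
    LaurentPolynomial.eval₂ (RingHom.id K) (Units.mk0 a ha)
  have evT : ev (LaurentPolynomial.T 1) = a := by
    simp only [ev, LaurentPolynomial.eval₂_T]; simp
  have evT' : ev (LaurentPolynomial.T (-1)) = a⁻¹ := by
    simp only [ev, LaurentPolynomial.eval₂_T]; simp
  have evC : ∀ x, ev (LaurentPolynomial.C x) = x := fun x => by
    simp only [ev, LaurentPolynomial.eval₂_C]; simp
  refine ⟨Quot.lift (fun b => (q - q⁻¹) / (a - a⁻¹) * ev (G b.1 b.2)) ?_, ?_, ?_⟩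
  · rintro _ _ (⟨α, β⟩ | β | β)
    · simp only [conj _ α β]
    · simp only [stab]
    · simp only [stabInv]
  · change (q - q⁻¹) / (a - a⁻¹) * ev (G 0 1) = 1
    have h := congrArg ev unknot_eq
    rw [map_mul, evC, map_sub, evT, evT'] at h
    rw [div_mul_eq_mul_div, h, div_self ha2]
  · intro k β i
    change a * ((q - q⁻¹) / (a - a⁻¹) * ev (G k (β * Braid.σ i))) -
      a⁻¹ * ((q - q⁻¹) / (a - a⁻¹) * ev (G k (β * (Braid.σ i)⁻¹))) =
      (q - q⁻¹) * ((q - q⁻¹) / (a - a⁻¹) * ev (G k β))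
    have h := congrArg ev (skein k β i)
    rw [map_sub, map_mul, map_mul, map_mul, evT, evT', evC] at h
    linear_combination ((q - q⁻¹) / (a - a⁻¹)) * h

theorem isHOMFLY_unique {K : Type*} [Field K] {a q : K} (ha : a ≠ 0) (hq2 : q - q⁻¹ ≠ 0) :
    ∀ P P' : OrientedLink → K, IsHOMFLY a q P → IsHOMFLY a q P' → P = P' := by
  intro P P' hP hP'
  have hm : ∀ (k : ℕ) (β : Braid k), P β.closure - P' β.closure ∈ (⊥ : Submodule K K) := by
    refine fun k => mem_of_markov (a := Units.mk0 a ha) (z := Units.mk0 _ hq2)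
      (fun k β => P (Braid.closure β) - P' (Braid.closure β)) ?_ ?_ ?_ ?_ ?_ k
    · intro k α β
      have : (α * β).closure = (β * α).closure := Quot.sound (MarkovMove.conj α β)
      rw [this]
    · intro k β
      have : β.closure = _ := Quot.sound (MarkovMove.stab β)
      rw [this]; rfl
    · intro k β
      have : β.closure = _ := Quot.sound (MarkovMove.stabInv β)
      rw [this]; rfl
    · intro k β i
      have h := hP.2 k β i
      have h' := hP'.2 k β i
      simp only [Units.smul_def, Units.val_mk0, Units.val_inv_eq_inv_val, smul_eq_mul]
      linear_combination h - h'
    · have h := hP.1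
      have h' := hP'.1
      rw [unknot] at h h'
      simp [h, h']
  funext L
  induction L using Quot.ind with
  | mk b => exact sub_eq_zero.mp ((Submodule.mem_bot K).mp (hm b.1 b.2))

/-- Over any field, for generic `a` and `q`, there is one and only one HOMFLY invariant. -/
theorem existsUnique_isHOMFLY {K : Type*} [Field K] {a q : K} (ha : a ≠ 0) (ha2 : a - a⁻¹ ≠ 0)
    (hq : q ≠ 0) (hinj : Function.Injective fun N : ℕ => q ^ N) : ∃! P, IsHOMFLY a q P :=
  existsUnique_of_exists_of_unique (exists_isHOMFLY ha ha2 hq hinj)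
    (isHOMFLY_unique ha (sub_inv_ne_zero hq hinj))

end HOMFLY

/-! ### Formal variables -/

/-- The field `ℚ(a)` of rational functions in the variable `a`. -/
abbrev FieldA : Type := RatFunc ℚ

/-- The field `ℚ(a)(q)` of rational functions in the variables `a` and `q`. -/
abbrev FieldAQ : Type := RatFunc FieldA

/-- The field `ℚ(a)((q))` of formal Laurent series in `q`. Its topology in Mathlib is the `q`-adic
one, and rational functions of `q` and power series in `q` are coerced to it by expansion at
`q = 0`. -/
abbrev SeriesAQ : Type := LaurentSeries FieldA

/-- The variable `a`, in `ℚ(a)(q)`. -/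
noncomputable def aVar : FieldAQ := RatFunc.C (RatFunc.X : FieldA)

/-- The variable `q`, in `ℚ(a)(q)`. -/
noncomputable def qVar : FieldAQ := RatFunc.X

theorem RatFunc_X_pow_injective (F : Type*) [Field F] :
    Function.Injective fun N : ℕ => (RatFunc.X : RatFunc F) ^ N := by
  intro m n h
  have h' : algebraMap (Polynomial F) (RatFunc F) (Polynomial.X ^ m) =
      algebraMap (Polynomial F) (RatFunc F) (Polynomial.X ^ n) := by
    simpa [RatFunc.algebraMap_X] using h
  simpa using congrArg Polynomial.natDegree (RatFunc.algebraMap_injective F h')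

theorem existsUnique_homfly : ∃! P, IsHOMFLY aVar qVar P := by
  have ha : aVar ≠ 0 := by
    rw [aVar, map_ne_zero]
    exact RatFunc.X_ne_zero
  refine HOMFLY.existsUnique_isHOMFLY ha (HOMFLY.sub_inv_ne_zero ha ?_) RatFunc.X_ne_zero
    (RatFunc_X_pow_injective FieldA)
  intro m n h
  refine RatFunc_X_pow_injective ℚ (RatFunc.C_injective (K := FieldA) ?_)
  simpa [aVar] using h

/-- The normalized HOMFLY polynomial `P(L)(a, q)` of an oriented link, as an element of
`ℚ(a)(q)`: the unique invariant that satisfies the skein relation and is `1` at the unknot. -/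
noncomputable def homfly : OrientedLink → FieldAQ := existsUnique_homfly.choose

theorem isHOMFLY_homfly : IsHOMFLY aVar qVar homfly := existsUnique_homfly.choose_spec.1

/-! ### The conjectured stable superpolynomial -/

/-- The series
`∏_{j=1}^{n-1} (1 + a² q^{2j} t^{2j+1}) / ∏_{j=2}^{n} (1 - q^{2j} t^{2j-2})`,
as a power series in `q` whose coefficients are polynomials in `t` over `ℚ(a)`. -/
noncomputable def stableSuperpolynomial (n : ℕ) : PowerSeries (Polynomial FieldA) :=
  (∏ j ∈ Finset.Icc 1 (n - 1),
      (1 + PowerSeries.C (Polynomial.C (RatFunc.X ^ 2) * Polynomial.X ^ (2 * j + 1)) *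
        PowerSeries.X ^ (2 * j))) *
    PowerSeries.invOfUnit
      (∏ j ∈ Finset.Icc 2 n,
        (1 - PowerSeries.C (Polynomial.X ^ (2 * j - 2)) * PowerSeries.X ^ (2 * j))) 1

/-- The substitution `t = -1`, coefficient by coefficient. -/
noncomputable def substNegOne : PowerSeries (Polynomial FieldA) →+* PowerSeries FieldA :=
  PowerSeries.map (Polynomial.evalRingHom (-1))

/-! Put `Q = q²` and `k = n - 1`. After rescaling by `c = q a⁻¹`, the skein relation says that `T =
c σ⁻¹` satisfies `(T - 1)(T + Q) = 0`. So the HOMFLY polynomial is a Markov trace on a Hecke algebra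
over `ℚ(a)[[q]]`, and `c ^ (k m) P(T_{m,n})` is the trace of `δ ^ m`, where `δ = T_0 ⋯ T_{k-1}` is a
Coxeter element.

The powers of `δ` converge `Q`-adically to the symmetrizer `E`, the idempotent with `T_i E = E T_i =
E`. Indeed `δ T_i = T_{i+1} δ`, and `T_{k-1}² ≡ T_{k-1}` modulo `Q`; hence `δ ^ k` absorbs every
`T_i` on the right modulo `Q`, and `δ ^ k ≡ δ ^ k E = E`. Since `E δ = δ E = E`, one has `(δ - E) ^
(k + 1) = δ ^ (k + 1) - E ≡ 0`, and powers of this congruence give convergence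
(`dvd_coxeter_pow_sub`). The quantum integers needed to build `E` are invertible because their
constant term is `1`.

Convergence passes to traces because the trace of an element of the algebra is a power series in
`q`, without poles (`IsMarkov.trace_mem`). This rests on the double coset decomposition `H_{k+1} =
H_k + H_k T_k H_k` (`genAlg_succ_le`) and on the fact that `c` and the value `d` of a split circle
are power series.

The trace of `E` is a product, one factor per added strand (`IsMarkov.trace_symmetrizer`), by the
recursive construction of `E` from cosets. Each factor equals `q a⁻¹ (1 - a² q^{2j}) / (1 -
q^{2j+2})` (`splitting_factor`). The powers of `q a⁻¹` account for the difference between the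
exponents `k m` and `(m - 1)(n - 1)`, and the rest is the substituted superpolynomial.

The Hecke algebra is realized concretely: its generators act by right translation on the functions
on the braid group that satisfy the skein relation, and the trace applies an operator to the
invariant itself and evaluates at the trivial braid. -/

/-! ### Hecke algebras of type A -/

namespace Hecke

variable {S A : Type*} [CommRing S] [Ring A] [Algebra S A]

/-- The first `k` terms of the sequence `T` satisfy the braid relations and the quadratic relation
`(T - 1) (T + Q) = 0`. -/
structure Rel (Q : S) (k : ℕ) (T : ℕ → A) : Prop where
  quad : ∀ i < k, T i * T i = (1 - Q) • T i + Q • 1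
  comm : ∀ i j, i + 1 < j → j < k → Commute (T i) (T j)
  braid : ∀ i, i + 1 < k → T i * T (i + 1) * T i = T (i + 1) * T i * T (i + 1)

theorem Rel.mono {Q : S} {k l : ℕ} {T : ℕ → A} (h : Rel Q l T) (hk : k ≤ l) : Rel Q k T :=
  ⟨fun i hi => h.quad i (hi.trans_le hk), fun i j hij hj => h.comm i j hij (hj.trans_le hk),
    fun i hi => h.braid i (hi.trans_le hk)⟩

/-- The sum `Q ^ k + Q ^ (k - 1) T_{k-1} + ⋯ + T_{k-1} ⋯ T_0` over the minimal representatives of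
the cosets of a maximal parabolic subgroup. -/
def cosetSum (Q : S) (T : ℕ → A) : ℕ → A
  | 0 => 1
  | k + 1 => Q ^ (k + 1) • 1 + T k * cosetSum Q T k

/-- The symmetrizer of the Hecke algebra, `r k` standing for the inverse of
`1 + Q + ⋯ + Q ^ k`. -/
def symmetrizer (Q : S) (r : ℕ → S) (T : ℕ → A) : ℕ → A
  | 0 => 1
  | k + 1 => r (k + 1) • (symmetrizer Q r T k * cosetSum Q T (k + 1))

/-- The Coxeter element `T_0 T_1 ⋯ T_{k-1}`. -/
def coxeter (T : ℕ → A) : ℕ → A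
  | 0 => 1
  | k + 1 => coxeter T k * T k

/-! ### Absorption of generators by the symmetrizer -/

theorem commute_cosetSum {Q : S} {T : ℕ → A} {y : A} :
    ∀ {k : ℕ}, (∀ i < k, Commute (T i) y) → Commute (cosetSum Q T k) y
  | 0, _ => Commute.one_left y
  | k + 1, h => ((Commute.one_left y).smul_left _).add_left
      ((h k k.lt_succ_self).mul_left (commute_cosetSum fun i hi => h i (hi.trans k.lt_succ_self)))

theorem commute_coxeter {T : ℕ → A} {y : A} :
    ∀ {k : ℕ}, (∀ i < k, Commute (T i) y) → Commute (coxeter T k) y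
  | 0, _ => Commute.one_left y
  | k + 1, h => (commute_coxeter fun i hi => h i (hi.trans k.lt_succ_self)).mul_left
      (h k k.lt_succ_self)

/-- The inductive step in building the symmetrizer: an element absorbing the generators of a maximal
parabolic subalgebra absorbs one more after multiplication by the coset sum. Letting `x` vary is
essential, since the induction is applied to `x * T (k + 1)`. -/
theorem mul_cosetSum_mul {Q : S} {T : ℕ → A} :
    ∀ {k : ℕ}, Rel Q (k + 1) T → ∀ {x : A}, (∀ i < k, x * T i = x) → ∀ i < k + 1,
      x * cosetSum Q T (k + 1) * T i = x * cosetSum Q T (k + 1) := by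
  intro k
  induction k with
  | zero =>
    intro hT x _ i hi
    obtain rfl : i = 0 := by omega
    simp only [cosetSum, mul_one, mul_assoc, add_mul, hT.quad 0 hi, smul_mul_assoc, one_mul]
    congr 1
    module
  | succ k ih =>
    intro hT x hx i hi
    have e : x * cosetSum Q T (k + 2) =
        Q ^ (k + 2) • x + x * T (k + 1) * cosetSum Q T (k + 1) := by
      rw [cosetSum, mul_add, mul_smul_comm, mul_one, mul_assoc]
    -- For `i ≤ k`, the element `x * T (k + 1)` still absorbs `T j` for `j < k`, by far
    -- commutativity. For `i = k + 1`, the coset sum is unfolded once more: the braid relation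
    -- handles its longest part, and the quadratic relation the two remaining terms.
    rcases (Nat.lt_succ_iff_lt_or_eq.mp hi) with hi' | rfl
    · have h := ih (hT.mono (Nat.le_succ _)) (x := x * T (k + 1)) (fun j hj => by
        rw [mul_assoc, ← (hT.comm j (k + 1) (by omega) (by omega)).eq, ← mul_assoc,
          hx j (by omega)]) i hi'
      rw [e, add_mul, h, smul_mul_assoc, hx i hi']
    · have hc : Commute (cosetSum Q T k) (T (k + 1)) :=
        commute_cosetSum fun j hj => hT.comm j (k + 1) (by omega) (by omega)
      have h1 : x * T (k + 1) * (T k * cosetSum Q T k) * T (k + 1) =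
          x * T (k + 1) * (T k * cosetSum Q T k) := by
        calc _ = x * (T (k + 1) * T k * T (k + 1)) * cosetSum Q T k := by
              simp only [mul_assoc, hc.eq]
          _ = (x * T k) * T (k + 1) * T k * cosetSum Q T k := by
              rw [← hT.braid k hi]; simp only [mul_assoc]
          _ = _ := by rw [hx k k.lt_succ_self]; simp only [mul_assoc]
      rw [e, cosetSum, mul_add, add_mul, add_mul, h1]
      simp only [mul_smul_comm, mul_one, smul_mul_assoc, mul_assoc, hT.quad _ hi, mul_add]
      module

theorem symmetrizer_mul {Q : S} {r : ℕ → S} {T : ℕ → A} {k : ℕ} (hT : Rel Q k T) :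
    ∀ i < k, symmetrizer Q r T k * T i = symmetrizer Q r T k := by
  induction k with
  | zero => simp
  | succ k ih =>
    intro i hi
    rw [symmetrizer, smul_mul_assoc,
      mul_cosetSum_mul hT (ih (hT.mono k.le_succ)) i hi]

/-- Modulo `p` the generators act on `x` by the character `T_i ↦ 1`, under which the coset sum
becomes a quantum integer. Taking `p = 0` turns the congruence into an equality; this specialization
is used throughout. -/
theorem dvd_mul_cosetSum {Q p : S} {T : ℕ → A} {k : ℕ} {x : A}
    (hx : ∀ i < k, algebraMap S A p ∣ T i * x - x) :
    algebraMap S A p ∣ cosetSum Q T k * x - (∑ j ∈ Finset.range (k + 1), Q ^ j) • x := by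
  induction k with
  | zero => simp [cosetSum]
  | succ k ih =>
    have h := (ih fun i hi => hx i (hi.trans k.lt_succ_self))
    have h2 : algebraMap S A p ∣ T k * (cosetSum Q T k * x -
        (∑ j ∈ Finset.range (k + 1), Q ^ j) • x) := by
      obtain ⟨y, hy⟩ := h
      exact ⟨T k * y, by rw [hy, ← mul_assoc, ← mul_assoc, Algebra.commutes]⟩
    have h3 : algebraMap S A p ∣ (∑ j ∈ Finset.range (k + 1), Q ^ j) • (T k * x - x) := by
      rw [← mul_one (_ • _), smul_mul_assoc, ← mul_smul_comm]
      exact (hx k k.lt_succ_self).mul_right _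
    convert dvd_add h2 h3 using 1
    rw [Finset.sum_range_succ _ (k + 1), cosetSum]
    simp only [add_mul, mul_sub, smul_mul_assoc, one_mul, mul_smul_comm, mul_assoc]
    module

/-- The factors `r` cancel the quantum integers produced by the coset sums, so the symmetrizer acts
as the identity on vectors invariant modulo `p`. -/
theorem dvd_symmetrizer_mul {Q p : S} {r : ℕ → S}
    (hr : ∀ k, r k * ∑ j ∈ Finset.range (k + 1), Q ^ j = 1) {T : ℕ → A} {k : ℕ} {x : A}
    (hx : ∀ i < k, algebraMap S A p ∣ T i * x - x) :
    algebraMap S A p ∣ symmetrizer Q r T k * x - x := by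
  induction k with
  | zero => simp [symmetrizer]
  | succ k ih =>
    obtain ⟨y, hy⟩ := dvd_mul_cosetSum (Q := Q) hx
    obtain ⟨z, hz⟩ := ih fun i hi => hx i (hi.trans k.lt_succ_self)
    refine ⟨r (k + 1) • (symmetrizer Q r T k * y) + z, ?_⟩
    rw [mul_add, ← hz, mul_smul_comm, ← mul_assoc, Algebra.commutes, mul_assoc, ← hy, mul_sub,
      smul_sub, mul_smul_comm, smul_smul, hr, one_smul, symmetrizer, smul_mul_assoc, mul_assoc]
    abel

open MulOpposite in
theorem Rel.op {Q : S} {k : ℕ} {T : ℕ → A} (hT : Rel Q k T) :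
    Rel Q k (fun i => op (T i)) where
  quad i hi := by rw [← op_mul, hT.quad i hi]; simp
  comm i j hij hj := (hT.comm i j hij hj).op
  braid i hi := by
    simp only [← op_mul, ← mul_assoc]
    rw [hT.braid i hi]

open MulOpposite in
-- The mirror images of the two preceding facts. The symmetrizer is defined asymmetrically, so the
-- point is that it coincides with the one formed in the opposite algebra.
theorem dvd_mul_symmetrizer {Q p : S} {r : ℕ → S}
    (hr : ∀ k, r k * ∑ j ∈ Finset.range (k + 1), Q ^ j = 1) {T : ℕ → A} {k : ℕ} (hT : Rel Q k T) :
    (∀ i < k, T i * symmetrizer Q r T k = symmetrizer Q r T k) ∧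
    ∀ x : A, (∀ i < k, algebraMap S A p ∣ x * T i - x) →
      algebraMap S A p ∣ x * symmetrizer Q r T k - x := by
  have hop : ∀ (p : S) (x : A), (∀ i < k, algebraMap S A p ∣ x * T i - x) →
      algebraMap S A p ∣ x * unop (symmetrizer Q r (fun i => op (T i)) k) - x := by
    intro p x hx
    have := dvd_symmetrizer_mul (A := Aᵐᵒᵖ) (p := p) hr (T := fun i => op (T i)) (k := k)
      (x := op x) (fun i hi => by
        obtain ⟨y, hy⟩ := hx i hi
        refine ⟨op y, ?_⟩
        rw [← op_mul, ← op_sub, hy, Algebra.commutes, op_mul]; rfl)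
    obtain ⟨y, hy⟩ := this
    refine ⟨unop y, ?_⟩
    have := congrArg unop hy
    rw [unop_sub, unop_mul, unop_mul] at this
    rw [Algebra.commutes]
    exact this
  have hl : ∀ i < k, T i * unop (symmetrizer Q r (fun i => op (T i)) k) =
      unop (symmetrizer Q r (fun i => op (T i)) k) := fun i hi =>
    congrArg unop (symmetrizer_mul (r := r) hT.op i hi)
  -- With `E'` the symmetrizer of the opposite algebra, `E * E' = E` because `E` absorbs on the
  -- right, and `E * E' = E'` because `E'` absorbs on the left; so `E = E'`.
  have e1 := hop 0 (symmetrizer Q r T k) (fun i hi => by rw [symmetrizer_mul hT i hi]; simp)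
  have e2 := dvd_symmetrizer_mul (p := 0) hr
    (x := unop (symmetrizer Q r (fun i => op (T i)) k)) (fun i hi => by rw [hl i hi]; simp)
  rw [map_zero, zero_dvd_iff, sub_eq_zero] at e1 e2
  rw [e1] at e2
  rw [← e2] at hl hop
  exact ⟨hl, hop p⟩

/-! ### Powers of the Coxeter element modulo `Q` -/

theorem coxeter_mul {Q : S} {T : ℕ → A} {k : ℕ} (hT : Rel Q k T) :
    ∀ i, i + 1 < k → coxeter T k * T i = T (i + 1) * coxeter T k := by
  induction k with
  | zero => intro i hi; omega
  | succ k ih =>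
    intro i hi
    rcases Nat.lt_succ_iff_lt_or_eq.mp hi with h | rfl
    · rw [coxeter, mul_assoc, ← (hT.comm i k h k.lt_succ_self).eq, ← mul_assoc,
        ih (hT.mono k.le_succ) i h, mul_assoc]
    · have hc : Commute (coxeter T i) (T (i + 1)) :=
        commute_coxeter fun j hj => hT.comm j (i + 1) (by omega) hi
      simp only [coxeter]
      rw [mul_assoc, mul_assoc, ← mul_assoc (T i), hT.braid i hi]
      simp only [← mul_assoc, hc.eq]

/-- Each factor of the Coxeter element that a generator crosses raises its index by one. Once the
index is `k - 1`, the generator meets its own copy at the end of the Coxeter element and is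
absorbed, being idempotent modulo `Q`. With `j = k` all generators are absorbed. -/
theorem dvd_coxeter_pow {Q : S} {T : ℕ → A} {k : ℕ} (hT : Rel Q k T) :
    ∀ j i, i < k → k ≤ i + j →
      algebraMap S A Q ∣ coxeter T k ^ j * T i - coxeter T k ^ j := by
  intro j
  induction j with
  | zero => intro i hi h; omega
  | succ j ih =>
    intro i hi h
    rcases Nat.lt_or_ge (i + 1) k with h1 | h1
    · obtain ⟨y, hy⟩ := ih (i + 1) h1 (by omega)
      refine ⟨y * coxeter T k, ?_⟩
      rw [← mul_assoc, ← hy, sub_mul, pow_succ, mul_assoc, coxeter_mul hT i h1, mul_assoc]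
    · obtain rfl : k = i + 1 := by omega
      -- The quadratic relation reads `T i * T i - T i = Q • (1 - T i)`.
      refine ⟨coxeter T (i + 1) ^ j * (coxeter T i * (1 - T i)), ?_⟩
      rw [← Algebra.smul_def, pow_succ]
      simp only [coxeter, mul_assoc, hT.quad i hi, ← mul_sub, ← mul_smul_comm]
      congr 2
      module

theorem mul_coxeter {T : ℕ → A} {x : A} : ∀ {k : ℕ}, (∀ i < k, x * T i = x) →
    x * coxeter T k = x
  | 0, _ => mul_one x
  | k + 1, h => by
    rw [coxeter, ← mul_assoc, mul_coxeter fun i hi => h i (hi.trans k.lt_succ_self),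
      h k k.lt_succ_self]

theorem coxeter_mul_of {T : ℕ → A} {x : A} : ∀ {k : ℕ}, (∀ i < k, T i * x = x) →
    coxeter T k * x = x
  | 0, _ => one_mul x
  | k + 1, h => by
    rw [coxeter, mul_assoc, h k k.lt_succ_self,
      coxeter_mul_of fun i hi => h i (hi.trans k.lt_succ_self)]

/-! ### Parabolic subalgebras and double cosets -/

/-- The subalgebra generated by the first `k` terms of the sequence `T`. -/
abbrev genAlg (S : Type*) {A : Type*} [CommRing S] [Ring A] [Algebra S A] (T : ℕ → A) (k : ℕ) :
    Subalgebra S A := Algebra.adjoin S (T '' Set.Iio k)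

theorem genAlg_mono (T : ℕ → A) {k l : ℕ} (h : k ≤ l) : genAlg S T k ≤ genAlg S T l :=
  Algebra.adjoin_mono (Set.image_mono (Set.Iio_subset_Iio h))

theorem mem_genAlg (T : ℕ → A) {i k : ℕ} (h : i < k) : T i ∈ genAlg S T k :=
  Algebra.subset_adjoin ⟨i, h, rfl⟩

theorem cosetSum_mem (Q : S) (T : ℕ → A) (k : ℕ) :
    cosetSum Q T k ∈ genAlg S T k := by
  induction k with
  | zero => exact one_mem _
  | succ k ih =>
    exact add_mem (Subalgebra.smul_mem _ (one_mem _) _)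
      (mul_mem (mem_genAlg _ k.lt_succ_self) (genAlg_mono _ k.le_succ ih))

theorem symmetrizer_mem (Q : S) (r : ℕ → S) (T : ℕ → A)
    (k : ℕ) : symmetrizer Q r T k ∈ genAlg S T k := by
  induction k with
  | zero => exact one_mem _
  | succ k ih =>
    exact Subalgebra.smul_mem _ (mul_mem (genAlg_mono _ k.le_succ ih) (cosetSum_mem Q T _)) _

open Submodule in
/-- The double coset decomposition with respect to a maximal parabolic subgroup. -/
theorem genAlg_succ_le {Q : S} {T : ℕ → A} {k : ℕ} (hT : Rel Q (k + 1) T) :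
    (genAlg S T (k + 1)).toSubmodule ≤ (genAlg S T k).toSubmodule ⊔
      (genAlg S T k).toSubmodule * span S {T k} * (genAlg S T k).toSubmodule := by
  -- Write `B` for the smaller subalgebra and `t` for the span of the new generator. If `t B t ⊆ B +
  -- B t B`, then `B + B t B` contains `1` and is stable under left multiplication by all
  -- generators, hence contains the larger subalgebra.
  have main : ∀ k, Rel Q (k + 1) T →
      span S {T k} * (genAlg S T k).toSubmodule * span S {T k} ≤ (genAlg S T k).toSubmodule ⊔
        (genAlg S T k).toSubmodule * span S {T k} * (genAlg S T k).toSubmodule →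
      (genAlg S T (k + 1)).toSubmodule ≤ (genAlg S T k).toSubmodule ⊔
        (genAlg S T k).toSubmodule * span S {T k} * (genAlg S T k).toSubmodule := by
    intro k hT h
    set B := (genAlg S T k).toSubmodule with hB
    set t := span S {T k}
    have hBB : B * B ≤ B := (Subalgebra.isIdempotentElem_toSubmodule _).le
    have h1B : 1 ≤ B := Submodule.one_le.mpr (one_mem (genAlg S T k))
    have htN : t * (B ⊔ B * t * B) ≤ B ⊔ B * t * B := by
      rw [Submodule.mul_sup]
      refine sup_le ?_ ?_
      · calc t * B = 1 * t * B := by rw [one_mul]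
          _ ≤ B * t * B := by gcongr
          _ ≤ _ := le_sup_right
      · calc t * (B * t * B) = t * B * t * B := by simp only [mul_assoc]
          _ ≤ (B ⊔ B * t * B) * B := by gcongr
          _ = B * B ⊔ B * t * (B * B) := by rw [Submodule.sup_mul, mul_assoc (B * t)]
          _ ≤ _ := by gcongr
    have hBN : B * (B ⊔ B * t * B) ≤ B ⊔ B * t * B := by
      rw [Submodule.mul_sup, ← mul_assoc, ← mul_assoc]
      gcongr
    have hgen : ∀ x ∈ genAlg S T (k + 1), ∀ n ∈ B ⊔ B * t * B, x * n ∈ B ⊔ B * t * B := by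
      intro x hx
      induction hx using Algebra.adjoin_induction with
      | mem x hx =>
        intro n hn
        obtain ⟨i, hi, rfl⟩ := hx
        rcases Nat.lt_succ_iff_lt_or_eq.mp hi with hi | rfl
        · exact hBN (mul_mem_mul (mem_genAlg T hi) hn)
        · exact htN (mul_mem_mul (mem_span_singleton_self _) hn)
      | algebraMap s => intro n hn; rw [← Algebra.smul_def]; exact smul_mem _ s hn
      | add x y _ _ hx hy => intro n hn; rw [add_mul]; exact add_mem (hx n hn) (hy n hn)
      | mul x y _ _ hx hy => intro n hn; rw [mul_assoc x y n]; exact hx _ (hy n hn)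
    intro x hx
    simpa using hgen x hx 1 (le_sup_left (a := B) (Submodule.one_le.mp h1B))
  have hquad : ∀ k, Rel Q (k + 1) T → span S {T k} * span S {T k} ≤ span S {T k} ⊔ 1 := by
    intro k hT
    rw [span_mul_span, Set.singleton_mul_singleton, span_singleton_le_iff_mem, hT.quad k (by omega)]
    exact add_mem (mem_sup_left (smul_mem _ _ (mem_span_singleton_self _)))
      (mem_sup_right (smul_mem _ _ (Submodule.one_le.mp le_rfl)))
  induction k with
  | zero =>
    refine main 0 hT ?_
    have h0 : (genAlg S T 0).toSubmodule = 1 := by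
      rw [genAlg, show Set.Iio 0 = (∅ : Set ℕ) by ext; simp, Set.image_empty, Algebra.adjoin_empty,
        Algebra.toSubmodule_bot]
    rw [h0, mul_one, mul_one, one_mul, sup_comm]
    exact hquad 0 hT
  | succ k ih =>
    refine main (k + 1) hT ?_
    have hT' := hT.mono (Nat.le_succ (k + 1))
    have hmono : (genAlg S T k).toSubmodule ≤ (genAlg S T (k + 1)).toSubmodule :=
      genAlg_mono T k.le_succ
    have hcomm : span S {T (k + 1)} * (genAlg S T k).toSubmodule =
        (genAlg S T k).toSubmodule * span S {T (k + 1)} := by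
      have hle : genAlg S T k ≤ Subalgebra.centralizer S {T (k + 1)} := by
        refine Algebra.adjoin_le ?_
        rintro _ ⟨i, hi, rfl⟩
        rw [SetLike.mem_coe, Subalgebra.mem_centralizer_iff]
        rintro _ rfl
        exact (hT.comm i (k + 1) (by simpa using hi) (by omega)).eq.symm
      have hc : ∀ y ∈ genAlg S T k, T (k + 1) * y = y * T (k + 1) := fun y hy =>
        (Subalgebra.mem_centralizer_iff S).mp (hle hy) _ rfl
      refine le_antisymm (Submodule.mul_le.mpr fun x hx y hy => ?_)
        (Submodule.mul_le.mpr fun y hy x hx => ?_)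
      · obtain ⟨s, rfl⟩ := mem_span_singleton.mp hx
        rw [smul_mul_assoc, hc y hy]
        exact smul_mem _ _ (mul_mem_mul hy (mem_span_singleton_self _))
      · obtain ⟨s, rfl⟩ := mem_span_singleton.mp hx
        rw [mul_smul_comm, ← hc y hy]
        exact smul_mem _ _ (mul_mem_mul (mem_span_singleton_self _) hy)
    have hbraid : span S {T (k + 1)} * span S {T k} * span S {T (k + 1)} =
        span S {T k} * span S {T (k + 1)} * span S {T k} := by
      simp only [span_mul_span, Set.singleton_mul_singleton, hT.braid k (by omega)]
    have hB := ih hT'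
    have hs : span S {T k} ≤ (genAlg S T (k + 1)).toSubmodule :=
      (span_singleton_le_iff_mem _ _).mpr (mem_genAlg T k.lt_succ_self)
    have hBB : (genAlg S T (k + 1)).toSubmodule * (genAlg S T (k + 1)).toSubmodule ≤
      (genAlg S T (k + 1)).toSubmodule := (Subalgebra.isIdempotentElem_toSubmodule _).le
    have h1B : 1 ≤ (genAlg S T (k + 1)).toSubmodule :=
      Submodule.one_le.mpr (one_mem (genAlg S T (k + 1)))
    have hq := hquad (k + 1) hT
    generalize (genAlg S T (k + 1)).toSubmodule = B at *
    generalize (genAlg S T k).toSubmodule = C at *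
    generalize span S {T (k + 1)} = t at *
    generalize span S {T k} = s at *
    -- The induction hypothesis splits `B` as `C + C s C`. Since `t` commutes with `C`, the two
    -- parts become `C t²` and `C (t s t) C`, to which the quadratic and the braid relations apply.
    calc t * B * t ≤ t * (C ⊔ C * s * C) * t := by gcongr
      _ = t * C * t ⊔ t * C * s * (C * t) := by
        rw [Submodule.mul_sup, Submodule.sup_mul]; simp only [mul_assoc]
      _ = C * (t * t) ⊔ C * (s * t * s) * C := by
        congr 1
        · rw [hcomm, mul_assoc]
        · rw [← hbraid, hcomm, ← hcomm, ← mul_assoc, hcomm]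
          simp only [mul_assoc, hcomm]
      _ ≤ C * (t ⊔ 1) ⊔ B * (B * t * B) * B := by gcongr
      _ = C * t * 1 ⊔ C ⊔ B * B * t * (B * B) := by
        rw [Submodule.mul_sup, mul_one, mul_one]; simp only [mul_assoc]
      _ ≤ B * t * B ⊔ B ⊔ B * t * B := by gcongr
      _ = B ⊔ B * t * B := by rw [sup_comm (B * t * B), sup_assoc, sup_idem]

/-! ### Convergence to the symmetrizer -/

/-- The powers of the Coxeter element converge `Q`-adically to the symmetrizer. -/
theorem dvd_coxeter_pow_sub {Q : S} {r : ℕ → S}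
    (hr : ∀ k, r k * ∑ j ∈ Finset.range (k + 1), Q ^ j = 1) {T : ℕ → A} {k : ℕ} (hT : Rel Q k T)
    (l m : ℕ) (hm : (k + 1) * (l + 1) ≤ m) :
    algebraMap S A Q ^ l ∣ coxeter T k ^ m - symmetrizer Q r T k := by
  set E := symmetrizer Q r T k
  set δ := coxeter T k
  have hE : E * δ = E := mul_coxeter (symmetrizer_mul hT)
  have hE' : δ * E = E := coxeter_mul_of (dvd_mul_symmetrizer (p := 0) hr hT).1
  have hEE : E * E = E := by
    have := (dvd_mul_symmetrizer (p := 0) hr hT).2 E fun i hi => by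
      rw [symmetrizer_mul hT i hi, sub_self]; exact dvd_zero _
    rwa [map_zero, zero_dvd_iff, sub_eq_zero] at this
  have hδE : ∀ m, δ ^ m * E = E := by
    intro m
    induction m with
    | zero => simp
    | succ m ih => rw [pow_succ, mul_assoc, hE', ih]
  have hpow : ∀ m, (δ - E) ^ (m + 1) = δ ^ (m + 1) - E := by
    intro m
    induction m with
    | zero => simp
    | succ m ih =>
      rw [pow_succ, ih, sub_mul, mul_sub, mul_sub, hE, hEE, hδE, pow_succ δ (m + 1)]
      abel
  have hQ : ∃ y, (δ - E) ^ (k + 1) = algebraMap S A Q * y := by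
    obtain ⟨y, hy⟩ := (dvd_mul_symmetrizer (p := Q) hr hT).2 (δ ^ k)
      (fun i hi => dvd_coxeter_pow hT k i hi (by omega))
    -- Here `δ ^ (k + 1) - E = -δ * (δ ^ k * E - δ ^ k)`, and `y` is the quotient of the last factor
    -- by `Q`.
    refine ⟨-(δ * y), ?_⟩
    rw [hpow, mul_neg, ← mul_assoc, Algebra.commutes, mul_assoc, ← hy, mul_sub, ← mul_assoc,
      ← pow_succ', hδE]
    abel
  obtain ⟨y, hy⟩ := hQ
  -- The remainder is kept positive because `hpow` holds only for positive exponents.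
  obtain ⟨s, rfl⟩ : ∃ s, m = (k + 1) * l + (s + 1) :=
    ⟨m - (k + 1) * l - 1, by
      have : (k + 1) * (l + 1) = (k + 1) * l + k + 1 := by ring
      omega⟩
  rw [← add_assoc, ← hpow, add_assoc, pow_add, pow_mul, hy,
    (Algebra.commute_algebraMap_left Q y).mul_pow, mul_assoc]
  exact Dvd.intro _ rfl

/-- The quotient by `Q ^ l` must lie in the generated subalgebra for its trace to be controlled.
Hence the divisibility is applied inside that subalgebra and not in `A`. -/
theorem exists_coxeter_pow_eq {Q : S} {r : ℕ → S}
    (hr : ∀ k, r k * ∑ j ∈ Finset.range (k + 1), Q ^ j = 1) {T : ℕ → A} {k : ℕ} (hT : Rel Q k T)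
    (l m : ℕ) (hm : (k + 1) * (l + 1) ≤ m) :
    ∃ y ∈ genAlg S T k, coxeter T k ^ m = symmetrizer Q r T k + Q ^ l • y := by
  set L := genAlg S T k
  let T' : ℕ → L := fun i => if h : i < k then ⟨T i, mem_genAlg T h⟩ else 0
  have hval : ∀ i < k, (T' i : A) = T i := fun i hi => by simp only [T', dif_pos hi]
  have hT' : Rel Q k T' := by
    refine ⟨fun i hi => Subtype.ext ?_, fun i j hij hj => Subtype.ext ?_,
      fun i hi => Subtype.ext ?_⟩
    · simpa [hval i hi] using hT.quad i hi
    · simpa [hval i (by omega), hval j hj] using (hT.comm i j hij hj).eq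
    · simpa [hval i (by omega), hval (i + 1) hi] using hT.braid i hi
  have e1 : ∀ j ≤ k, ((coxeter T' j : L) : A) = coxeter T j := by
    intro j hj
    induction j with
    | zero => rfl
    | succ j ih => simp [coxeter, ← ih (by omega), hval j hj]
  have e2 : ∀ j ≤ k, ((cosetSum Q T' j : L) : A) = cosetSum Q T j := by
    intro j hj
    induction j with
    | zero => rfl
    | succ j ih => simp [cosetSum, ← ih (by omega), hval j hj]
  have e3 : ∀ j ≤ k, ((symmetrizer Q r T' j : L) : A) = symmetrizer Q r T j := by
    intro j hj
    induction j with
    | zero => rfl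
    | succ j ih => simp [symmetrizer, ← ih (by omega), ← e2 _ hj]
  obtain ⟨y, hy⟩ := dvd_coxeter_pow_sub hr hT' l m hm
  refine ⟨y, y.2, ?_⟩
  rw [← map_pow, ← Algebra.smul_def, sub_eq_iff_eq_add'] at hy
  simpa [e1 k le_rfl, e3 k le_rfl] using congrArg Subtype.val hy

end Hecke

/-! ### Skein functions on braid groups -/

namespace Hecke

variable {S M : Type*} [CommRing S] [AddCommGroup M] [Module S M]

/-- The functions on a braid group that satisfy the Hecke relation for `c σ⁻¹`. -/
def skeinFun (M : Type*) [AddCommGroup M] [Module S M] (Q c : S) (k : ℕ) :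
    Submodule S (Braid k → M) where
  carrier := {g | ∀ (α β : Braid k) (i : Fin k),
    c ^ 2 • g (α * (Braid.σ i)⁻¹ * (Braid.σ i)⁻¹ * β) =
      ((1 - Q) * c) • g (α * (Braid.σ i)⁻¹ * β) + Q • g (α * β)}
  add_mem' hf hg α β i := by
    simp only [Pi.add_apply, smul_add, hf α β i, hg α β i]; abel
  zero_mem' α β i := by simp
  smul_mem' s f hf α β i := by
    simp only [Pi.smul_apply, smul_comm _ s, hf α β i, smul_add]

variable {Q c : S} {k : ℕ}

/-! ### Translations and the Hecke action -/

/-- Right translation of skein functions. -/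
def rightTranslation (γ : Braid k) : Module.End S (skeinFun M Q c k) where
  toFun g := ⟨fun β => g.1 (β * γ), fun α β i => by
    simpa [mul_assoc] using g.2 α (β * γ) i⟩
  map_add' _ _ := rfl
  map_smul' _ _ := rfl

/-- Left translation of skein functions. -/
def leftTranslation (γ : Braid k) : Module.End S (skeinFun M Q c k) where
  toFun g := ⟨fun β => g.1 (γ * β), fun α β i => by
    simpa [mul_assoc] using g.2 (γ * α) β i⟩
  map_add' _ _ := rfl
  map_smul' _ _ := rfl

theorem rightTranslation_mul (γ γ' : Braid k) :
    (rightTranslation (γ * γ') : Module.End S (skeinFun M Q c k)) =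
      rightTranslation γ * rightTranslation γ' := by
  ext g β
  exact congrArg g.1 (mul_assoc _ _ _).symm

theorem rightTranslation_one :
    (rightTranslation 1 : Module.End S (skeinFun M Q c k)) = 1 := by
  ext g β
  exact congrArg g.1 (mul_one _)

/-- The action of the generators of the Hecke algebra on skein functions. -/
def gen (M : Type*) [AddCommGroup M] [Module S M] (Q c : S) (k i : ℕ) :
    Module.End S (skeinFun M Q c k) :=
  if h : i < k then c • rightTranslation (Braid.σ ⟨i, h⟩)⁻¹ else 0

theorem gen_of_lt {i : ℕ} (h : i < k) :
    gen M Q c k i = c • rightTranslation (Braid.σ ⟨i, h⟩)⁻¹ := dif_pos h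

/-- The quadratic relation is the defining condition of `skeinFun`; the other relations come from
the braid group, as right translation is multiplicative. -/
theorem rel_gen : Rel Q k (gen M Q c k) where
  quad i hi := by
    rw [gen_of_lt hi, smul_mul_smul_comm, ← rightTranslation_mul]
    ext g β
    have := g.2 β 1 ⟨i, hi⟩
    simp only [mul_one] at this
    simp only [LinearMap.smul_apply, LinearMap.add_apply, Submodule.coe_add, Submodule.coe_smul,
      Pi.add_apply, Pi.smul_apply, Module.End.one_apply]
    rw [smul_smul, ← pow_two]
    refine Eq.trans ?_ this
    rw [mul_assoc]
    rfl
  comm i j hij hj := by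
    rw [gen_of_lt hj, gen_of_lt ((Nat.lt_of_succ_lt hij).trans hj), Commute, SemiconjBy,
      smul_mul_smul_comm, smul_mul_smul_comm, ← rightTranslation_mul, ← rightTranslation_mul,
      ← mul_inv_rev, ← mul_inv_rev, Braid.σ_comm ⟨i, _⟩ ⟨j, _⟩ hij]
  braid i hi := by
    rw [gen_of_lt hi, gen_of_lt (Nat.lt_of_succ_lt hi)]
    simp only [smul_mul_smul_comm, ← rightTranslation_mul, ← mul_inv_rev, ← mul_assoc]
    rw [Braid.σ_braid _ _ rfl]

theorem coxeter_gen {l : ℕ} (hl : l ≤ k) : coxeter (gen M Q c k) l =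
    c ^ l • rightTranslation
      (List.ofFn fun i : Fin l => (Braid.σ (Fin.castLE hl i))⁻¹).prod := by
  induction l with
  | zero => simp [coxeter, rightTranslation_one]
  | succ l ih =>
    rw [coxeter, ih (Nat.le_of_succ_le hl), gen_of_lt hl, smul_mul_smul_comm,
      ← rightTranslation_mul, ← pow_succ, List.ofFn_succ', List.concat_eq_append,
      List.prod_append, List.prod_singleton]
    rfl

theorem rightTranslation_pow (γ : Braid k) (m : ℕ) :
    (rightTranslation γ : Module.End S (skeinFun M Q c k)) ^ m = rightTranslation (γ ^ m) := by
  induction m with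
  | zero => simp [rightTranslation_one]
  | succ m ih => rw [pow_succ, pow_succ, rightTranslation_mul, ih]

/-- Left and right translations commute by associativity. This is the source of the trace property.
-/
theorem commute_leftTranslation (γ : Braid k) {x : Module.End S (skeinFun M Q c k)} {l : ℕ}
    (hx : x ∈ genAlg S (gen M Q c k) l) : Commute (leftTranslation γ) x := by
  have h : genAlg S (gen M Q c k) l ≤ Subalgebra.centralizer S {leftTranslation γ} := by
    refine Algebra.adjoin_le ?_
    rintro _ ⟨i, -, rfl⟩
    rw [SetLike.mem_coe, Subalgebra.mem_centralizer_iff]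
    rintro _ rfl
    rw [gen]
    split_ifs with h
    · ext g β
      exact congrArg (fun x => c • g.1 x) (mul_assoc _ _ _)
    · simp
  exact (Subalgebra.mem_centralizer_iff S).mp (h hx) _ rfl

/-! ### Removing a strand -/

/-- The restriction of skein functions to a smaller braid group. -/
def restrict (M : Type*) [AddCommGroup M] [Module S M] (Q c : S) (k : ℕ) :
    skeinFun M Q c (k + 1) →ₗ[S] skeinFun M Q c k where
  toFun g := ⟨fun β => g.1 (Braid.addStrand k β), fun α β i => by
    simpa using g.2 (Braid.addStrand k α) (Braid.addStrand k β) i.castSucc⟩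
  map_add' _ _ := rfl
  map_smul' _ _ := rfl

theorem restrict_gen {i : ℕ} (hi : i < k) (g : skeinFun M Q c (k + 1)) :
    restrict M Q c k (gen M Q c (k + 1) i g) = gen M Q c k i (restrict M Q c k g) := by
  rw [gen_of_lt hi, gen_of_lt (hi.trans k.lt_succ_self)]
  ext β
  change c • g.1 _ = c • g.1 _
  rw [map_mul, map_inv, Braid.addStrand_σ]
  rfl

/-- Operators not involving the last strand descend along restriction, so that their traces can be
computed on fewer strands. -/
theorem restrict_genAlg {x : Module.End S (skeinFun M Q c (k + 1))}
    (hx : x ∈ genAlg S (gen M Q c (k + 1)) k) : ∃ y ∈ genAlg S (gen M Q c k) k,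
      ∀ g, restrict M Q c k (x g) = y (restrict M Q c k g) := by
  induction hx using Algebra.adjoin_induction with
  | mem x hx =>
    obtain ⟨i, hi, rfl⟩ := hx
    exact ⟨_, mem_genAlg _ hi, restrict_gen hi⟩
  | algebraMap s => exact ⟨_, Subalgebra.algebraMap_mem _ s, fun g => rfl⟩
  | add x x' _ _ h h' =>
    obtain ⟨y, hy, e⟩ := h
    obtain ⟨y', hy', e'⟩ := h'
    exact ⟨y + y', add_mem hy hy', fun g => by simp [e, e']⟩
  | mul x x' _ _ h h' =>
    obtain ⟨y, hy, e⟩ := h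
    obtain ⟨y', hy', e'⟩ := h'
    exact ⟨y * y', mul_mem hy hy', fun g => by simp [e, e']⟩

theorem restrict_cosetSum {l : ℕ} (hl : l ≤ k) (g : skeinFun M Q c (k + 1)) :
    restrict M Q c k (cosetSum Q (gen M Q c (k + 1)) l g) =
      cosetSum Q (gen M Q c k) l (restrict M Q c k g) := by
  induction l with
  | zero => rfl
  | succ l ih => simp [cosetSum, restrict_gen hl, ih (Nat.le_of_succ_le hl)]

theorem restrict_symmetrizer (r : ℕ → S) {l : ℕ} (hl : l ≤ k) (g : skeinFun M Q c (k + 1)) :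
    restrict M Q c k (symmetrizer Q r (gen M Q c (k + 1)) l g) =
      symmetrizer Q r (gen M Q c k) l (restrict M Q c k g) := by
  induction l generalizing g with
  | zero => rfl
  | succ l ih =>
    simp only [symmetrizer, LinearMap.smul_apply, Module.End.mul_apply, map_smul,
      ih (Nat.le_of_succ_le hl), restrict_cosetSum hl]

/-! ### Markov traces -/

/-- A family of functions on the braid groups that satisfies the skein relation, for the
normalized generators `c σ⁻¹`, and Markov's moves, `d` being the value of a split circle. -/
structure IsMarkov (Q c d : S) (f : ∀ k, Braid k → M) : Prop where
  skein : ∀ k, f k ∈ skeinFun M Q c k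
  conj : ∀ k (α β : Braid k), f k (α * β) = f k (β * α)
  stabInv : ∀ k (β : Braid k),
    f (k + 1) (Braid.addStrand k β * (Braid.σ (Fin.last k))⁻¹) = f k β
  split : ∀ k (β : Braid k), f (k + 1) (Braid.addStrand k β) = d • f k β

namespace IsMarkov

variable {d : S} {f : ∀ k, Braid k → M}

/-- The trace on the Hecke algebra given by a Markov family. -/
def trace (hf : IsMarkov Q c d f) (k : ℕ) : Module.End S (skeinFun M Q c k) →ₗ[S] M where
  toFun x := (x ⟨f k, hf.skein k⟩).1 1
  map_add' _ _ := rfl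
  map_smul' _ _ := rfl

theorem trace_apply (hf : IsMarkov Q c d f) (x : Module.End S (skeinFun M Q c k)) :
    hf.trace k x = (x ⟨f k, hf.skein k⟩).1 1 := rfl

/-- It suffices to move one generator. Conjugation invariance says that left and right translation
by `s` agree on `f k`; the left one passes through `y`, and at the trivial braid both again give the
value at `s`. -/
theorem trace_mul_comm (hf : IsMarkov Q c d f) {x y : Module.End S (skeinFun M Q c k)}
    (hx : x ∈ genAlg S (gen M Q c k) k) (hy : y ∈ genAlg S (gen M Q c k) k) :
    hf.trace k (x * y) = hf.trace k (y * x) := by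
  induction hx using Algebra.adjoin_induction generalizing y with
  | mem x hx =>
    obtain ⟨i, hi, rfl⟩ := hx
    rw [gen_of_lt hi, smul_mul_assoc, mul_smul_comm, map_smul, map_smul]
    congr 1
    set s := (Braid.σ (⟨i, hi⟩ : Fin k))⁻¹
    have h1 : rightTranslation s ⟨f k, hf.skein k⟩ = leftTranslation s ⟨f k, hf.skein k⟩ := by
      ext β
      exact hf.conj k β s
    rw [trace_apply, trace_apply, Module.End.mul_apply, Module.End.mul_apply, h1,
      ← Module.End.mul_apply y, ← (commute_leftTranslation s hy).eq]
    change (y _).1 (1 * s) = (y _).1 (s * 1)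
    rw [one_mul, mul_one]
  | algebraMap s => rw [Algebra.commutes]
  | add x x' _ _ h h' => rw [add_mul, mul_add, map_add, map_add, h hy, h' hy]
  | mul x x' hx hx' h h' =>
    rw [mul_assoc, h (mul_mem hx' hy), mul_assoc, h' (mul_mem hy hx), mul_assoc]

theorem restrict_self (hf : IsMarkov Q c d f) :
    restrict M Q c k ⟨f (k + 1), hf.skein (k + 1)⟩ = d • ⟨f k, hf.skein k⟩ := by
  ext β
  exact hf.split k β

theorem restrict_gen_self (hf : IsMarkov Q c d f) :
    restrict M Q c k (gen M Q c (k + 1) k ⟨f (k + 1), hf.skein (k + 1)⟩) =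
      c • ⟨f k, hf.skein k⟩ := by
  rw [gen_of_lt k.lt_succ_self]
  ext β
  exact congrArg (c • ·) (hf.stabInv k β)

theorem trace_eq_restrict (hf : IsMarkov Q c d f) (x : Module.End S (skeinFun M Q c (k + 1))) :
    hf.trace (k + 1) x = (restrict M Q c k (x ⟨f (k + 1), hf.skein (k + 1)⟩)).1 1 := by
  rw [trace_apply]
  exact congrArg _ (map_one (Braid.addStrand k)).symm

/-- Integrality of the trace: by the double coset decomposition every element has at most one
occurrence of the last generator, and the Markov property then removes a strand at the cost of a
factor `d` or `c` in `S`. -/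
theorem trace_mem (hf : IsMarkov Q c d f) {W : Submodule S M} (h0 : f 0 1 ∈ W) :
    ∀ {k : ℕ} {x : Module.End S (skeinFun M Q c k)}, x ∈ genAlg S (gen M Q c k) k →
      hf.trace k x ∈ W := by
  intro k
  induction k with
  | zero =>
    intro x hx
    rw [genAlg, show Set.Iio 0 = (∅ : Set ℕ) by ext; simp, Set.image_empty, Algebra.adjoin_empty,
      Algebra.mem_bot] at hx
    obtain ⟨s, rfl⟩ := hx
    exact W.smul_mem s h0
  | succ k ih =>
    intro x hx
    have key : (genAlg S (gen M Q c (k + 1)) k).toSubmodule ⊔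
      (genAlg S (gen M Q c (k + 1)) k).toSubmodule * Submodule.span S {gen M Q c (k + 1) k} *
        (genAlg S (gen M Q c (k + 1)) k).toSubmodule ≤ W.comap (hf.trace (k + 1)) := by
      refine sup_le ?_ (Submodule.mul_le.mpr ?_)
      · intro x hx
        obtain ⟨y, hy, e⟩ := restrict_genAlg hx
        rw [Submodule.mem_comap, hf.trace_eq_restrict, e, hf.restrict_self, map_smul]
        exact W.smul_mem _ (ih hy)
      · intro u hu w hw
        rw [Submodule.mem_mul_span_singleton] at hu
        obtain ⟨v, hv, rfl⟩ := hu
        obtain ⟨y, hy, e⟩ := restrict_genAlg (mul_mem hw hv)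
        rw [Submodule.mem_comap, hf.trace_mul_comm
          (mul_mem (genAlg_mono _ k.le_succ hv) (mem_genAlg _ k.lt_succ_self))
          (genAlg_mono _ k.le_succ hw), ← mul_assoc, hf.trace_eq_restrict, Module.End.mul_apply, e,
          hf.restrict_gen_self, map_smul]
        exact W.smul_mem _ (ih hy)
    exact key (genAlg_succ_le rel_gen hx)

theorem trace_symmetrizer (hf : IsMarkov Q c d f) {r : ℕ → S}
    (hr : ∀ k, r k * ∑ j ∈ Finset.range (k + 1), Q ^ j = 1) (k : ℕ) :
    hf.trace k (symmetrizer Q r (gen M Q c k) k) =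
      (∏ j ∈ Finset.range k, (r (j + 1) * (Q ^ (j + 1) * d +
        (∑ i ∈ Finset.range (j + 1), Q ^ i) * c))) • f 0 1 := by
  induction k with
  | zero => simp [symmetrizer, trace_apply]
  | succ k ih =>
    set T := gen M Q c (k + 1)
    set E := symmetrizer Q r T k
    have hT : Rel Q k T := rel_gen.mono k.le_succ
    have hE : cosetSum Q T k * E = (∑ j ∈ Finset.range (k + 1), Q ^ j) • E := by
      have := dvd_mul_cosetSum (Q := Q) (p := 0) (T := T) (k := k) (x := E) fun i hi => by
        rw [(dvd_mul_symmetrizer (p := 0) hr hT).1 i hi, sub_self]; exact dvd_zero _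
      rwa [map_zero, zero_dvd_iff, sub_eq_zero] at this
    have hEmem : E ∈ genAlg S T (k + 1) := genAlg_mono _ k.le_succ (symmetrizer_mem Q r T k)
    have hV : cosetSum Q T k ∈ genAlg S T (k + 1) :=
      genAlg_mono _ k.le_succ (cosetSum_mem Q T k)
    have hTk : T k ∈ genAlg S T (k + 1) := mem_genAlg T k.lt_succ_self
    have h1 : hf.trace (k + 1) E = d • hf.trace k (symmetrizer Q r (gen M Q c k) k) := by
      rw [hf.trace_eq_restrict, restrict_symmetrizer r le_rfl, hf.restrict_self, map_smul]
      rfl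
    have h2 : hf.trace (k + 1) (E * T k) = c • hf.trace k (symmetrizer Q r (gen M Q c k) k) := by
      rw [hf.trace_eq_restrict, Module.End.mul_apply, restrict_symmetrizer r le_rfl,
        hf.restrict_gen_self, map_smul]
      rfl
    -- The coset sum splits as `Q ^ (k + 1) + T k * V`, with `V` the shorter coset sum. Cyclicity
    -- moves `V` to the left of `E`, where it acts as a quantum integer; the traces of `E` and `E *
    -- T k` then lose the last strand.
    rw [symmetrizer, cosetSum, map_smul, mul_add, map_add, mul_smul_comm, mul_one, map_smul,
      ← mul_assoc, hf.trace_mul_comm (mul_mem hEmem hTk) hV, ← mul_assoc, hE, smul_mul_assoc,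
      map_smul, h1, h2, ih, Finset.prod_range_succ]
    module

/-- The traces of the powers of the Coxeter element converge to that of the symmetrizer. -/
theorem exists_trace_coxeter_pow (hf : IsMarkov Q c d f) {r : ℕ → S}
    (hr : ∀ k, r k * ∑ j ∈ Finset.range (k + 1), Q ^ j = 1) {k l m : ℕ}
    (hm : (k + 1) * (l + 1) ≤ m) :
    ∃ s : S, c ^ (k * m) •
        f k ((List.ofFn fun i : Fin k => (Braid.σ i)⁻¹).prod ^ m) =
      (∏ j ∈ Finset.range k, (r (j + 1) * (Q ^ (j + 1) * d +
        (∑ i ∈ Finset.range (j + 1), Q ^ i) * c))) • f 0 1 + (Q ^ l * s) • f 0 1 := by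
  obtain ⟨y, hy, h⟩ := exists_coxeter_pow_eq hr (rel_gen (M := M) (c := c)) l m hm
  obtain ⟨s, hs⟩ := Submodule.mem_span_singleton.mp
    (hf.trace_mem (Submodule.mem_span_singleton_self (f 0 1)) hy)
  rw [coxeter_gen le_rfl, smul_pow, rightTranslation_pow, ← pow_mul] at h
  refine ⟨s, ?_⟩
  have h' := congrArg (hf.trace k) h
  rw [map_add, map_smul, map_smul, trace_symmetrizer hf hr, ← hs, smul_smul] at h'
  rw [← h', trace_apply]
  exact congrArg (fun x => _ • f k x) (one_mul _).symm

end IsMarkov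

end Hecke

/-! ### The limit -/

theorem LaurentSeries.tendsto_zero_of_X_pow_dvd {K ι : Type*} [Field K] {f : Filter ι}
    {u : ι → LaurentSeries K}
    (h : ∀ l : ℕ, ∀ᶠ i in f, ∃ s : PowerSeries K,
      u i = ((PowerSeries.X ^ l * s : PowerSeries K) : LaurentSeries K)) :
    Tendsto u f (𝓝 0) := by
  rw [(Valued.hasBasis_nhds_zero (LaurentSeries K) _).tendsto_right_iff]
  intro γ _
  have hγ : MonoidWithZeroHom.ValueGroup₀.embedding γ.1 ≠ 0 := by simp
  obtain ⟨l, hl⟩ : ∃ l : ℕ, -(l : ℤ) <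
      WithZero.log (MonoidWithZeroHom.ValueGroup₀.embedding γ.1) :=
    -- A multiple of `X ^ l` has valuation at most `exp (-l)`; the `+ 1` makes the inequality with
    -- `γ` strict.
    ⟨(-WithZero.log (MonoidWithZeroHom.ValueGroup₀.embedding γ.1) + 1).toNat, by omega⟩
  filter_upwards [h l] with i hi
  obtain ⟨s, hs⟩ := hi
  rw [Valuation.restrict_lt_iff_lt_embedding]
  refine lt_of_le_of_lt ?_ ((WithZero.lt_log_iff_exp_lt hγ).mp hl)
  rw [LaurentSeries.valuation_le_iff_coeff_lt_eq_zero, hs]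
  intro n hn
  rw [PowerSeries.coeff_coe]
  split_ifs with h0
  · rfl
  · rw [PowerSeries.coeff_X_pow_mul', if_neg (by omega)]

/-! ### The HOMFLY polynomial as a Markov family of Laurent series -/

/-- The variable `q`, as a Laurent series. -/
noncomputable abbrev qSer : SeriesAQ := HahnSeries.single 1 1

/-- The variable `a`, as a Laurent series. -/
noncomputable abbrev aSer : SeriesAQ := HahnSeries.C RatFunc.X

theorem coe_qVar : (qVar : SeriesAQ) = qSer := RatFunc.coe_X

theorem coe_aVar : (aVar : SeriesAQ) = aSer := by
  rw [aVar, ← RatFunc.algebraMap_C]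
  refine (RatFunc.coe_coe _).symm.trans ?_
  rw [Polynomial.coe_C, HahnSeries.ofPowerSeries_C]

theorem qVar_ne_zero : qVar ≠ 0 := RatFunc.X_ne_zero

theorem aVar_ne_zero : aVar ≠ 0 := by
  rw [aVar, map_ne_zero]
  exact RatFunc.X_ne_zero

theorem qSer_ne_zero : qSer ≠ 0 := by
  rw [← coe_qVar]; exact (map_ne_zero _).mpr qVar_ne_zero

theorem aSer_ne_zero : aSer ≠ 0 := by
  rw [← coe_aVar]; exact (map_ne_zero _).mpr aVar_ne_zero

theorem one_sub_qSer_pow_ne_zero {j : ℕ} (hj : j ≠ 0) : 1 - qSer ^ j ≠ 0 := by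
  have h : 1 - qVar ^ j ≠ 0 := fun h => hj
    (RatFunc_X_pow_injective FieldA ((sub_eq_zero.mp h).symm.trans (pow_zero _).symm))
  have : ((1 - qVar ^ j : FieldAQ) : SeriesAQ) ≠ 0 := (map_ne_zero _).mpr h
  rwa [map_sub, map_one, map_pow, coe_qVar] at this

theorem qSer_sub_inv_ne_zero : qSer - qSer⁻¹ ≠ 0 := by
  intro h
  refine one_sub_qSer_pow_ne_zero two_ne_zero ?_
  have := congrArg (qSer * ·) h
  simp only [mul_sub, mul_inv_cancel₀ qSer_ne_zero, mul_zero] at this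
  linear_combination -this

theorem homfly_skein {k : ℕ} (β : Braid k) (i : Fin k) :
    aSer * (homfly (β * Braid.σ i).closure : SeriesAQ) -
      aSer⁻¹ * (homfly (β * (Braid.σ i)⁻¹).closure : SeriesAQ) =
      (qSer - qSer⁻¹) * (homfly β.closure : SeriesAQ) := by
  have := congrArg (fun x : FieldAQ => (x : SeriesAQ)) (isHOMFLY_homfly.2 k β i)
  simpa only [map_sub, map_mul, map_inv₀, coe_aVar, coe_qVar] using this

/-- The factor `q a⁻¹`, as a power series. -/
noncomputable def cSer : PowerSeries FieldA := PowerSeries.C (RatFunc.X⁻¹) * PowerSeries.X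

/-- The value `(a - a⁻¹) / (q - q⁻¹)` of a split circle, as a power series. -/
noncomputable def dSer : PowerSeries FieldA :=
  PowerSeries.X * PowerSeries.C (RatFunc.X⁻¹ - RatFunc.X) * (1 - PowerSeries.X ^ 2)⁻¹

theorem coe_inv_powerSeries {K : Type*} [Field K] {p : PowerSeries K}
    (h : PowerSeries.constantCoeff p ≠ 0) :
    ((p⁻¹ : PowerSeries K) : LaurentSeries K) = (p : LaurentSeries K)⁻¹ := by
  refine eq_inv_of_mul_eq_one_left ?_
  rw [← map_mul, PowerSeries.inv_mul_cancel p h, map_one]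

theorem coe_cSer : (cSer : SeriesAQ) = qSer * aSer⁻¹ := by
  rw [cSer, map_mul, HahnSeries.ofPowerSeries_C, HahnSeries.ofPowerSeries_X, map_inv₀, mul_comm]

theorem coe_dSer : (dSer : SeriesAQ) = (aSer - aSer⁻¹) / (qSer - qSer⁻¹) := by
  have e1 : ((1 - PowerSeries.X ^ 2 : PowerSeries FieldA) : SeriesAQ) = 1 - qSer ^ 2 := by
    rw [map_sub, map_one, map_pow, HahnSeries.ofPowerSeries_X]
  have e2 : (HahnSeries.C (RatFunc.X⁻¹ - RatFunc.X : FieldA) : SeriesAQ) = aSer⁻¹ - aSer := by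
    rw [map_sub, map_inv₀]
  have h := one_sub_qSer_pow_ne_zero (j := 2) two_ne_zero
  have hq := qSer_ne_zero
  rw [dSer, map_mul, map_mul, coe_inv_powerSeries (by simp), HahnSeries.ofPowerSeries_C,
    HahnSeries.ofPowerSeries_X, e1, e2]
  change qSer * _ * _ = _
  rw [eq_div_iff qSer_sub_inv_ne_zero]
  generalize aSer⁻¹ = b
  generalize aSer = a
  generalize qSer = q at *
  field_simp
  ring

/-- The values of the HOMFLY polynomial at closed braids, as Laurent series. -/
noncomputable def homflySer (k : ℕ) (β : Braid k) : SeriesAQ := (homfly β.closure : SeriesAQ)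

theorem isMarkov_homflySer : Hecke.IsMarkov (PowerSeries.X ^ 2) cSer dSer homflySer := by
  have conj : ∀ k (α β : Braid k), homflySer k (α * β) = homflySer k (β * α) := by
    intro k α β
    have : (α * β).closure = (β * α).closure := Quot.sound (MarkovMove.conj α β)
    rw [homflySer, homflySer, this]
  have stab : ∀ k (β : Braid k),
      homflySer (k + 1) (Braid.addStrand k β * Braid.σ (Fin.last k)) = homflySer k β := by
    intro k β
    have : β.closure = _ := Quot.sound (MarkovMove.stab β)
    rw [homflySer, homflySer, this]; rfl
  have stabInv : ∀ k (β : Braid k),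
      homflySer (k + 1) (Braid.addStrand k β * (Braid.σ (Fin.last k))⁻¹) = homflySer k β := by
    intro k β
    have : β.closure = _ := Quot.sound (MarkovMove.stabInv β)
    rw [homflySer, homflySer, this]; rfl
  have smul_def : ∀ (p : PowerSeries FieldA) (x : SeriesAQ), p • x = (p : SeriesAQ) * x :=
    fun p x => Algebra.smul_def p x
  refine ⟨fun k α β i => ?_, conj, stabInv, fun k β => ?_⟩
  -- After conjugating the crossing to the end, the skein relation is applied with one extra
  -- negative crossing. This turns it into a quadratic relation in `σ⁻¹`, which is then multiplied
  -- by `-q² a⁻¹`.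
  · have h := homfly_skein (β * α * (Braid.σ i)⁻¹) i
    rw [inv_mul_cancel_right] at h
    change aSer * homflySer k (β * α) - aSer⁻¹ * homflySer k _ = _ * homflySer k _ at h
    rw [conj _ _ β, conj _ _ β, conj _ _ β]
    simp only [← mul_assoc, smul_def, map_mul, map_sub, map_one, map_pow, coe_cSer,
      HahnSeries.ofPowerSeries_X]
    generalize homflySer k _ = x at h ⊢
    generalize homflySer k _ = y at h ⊢
    generalize homflySer k _ = w at h ⊢
    linear_combination (-(qSer ^ 2 * aSer⁻¹)) * h +
      qSer ^ 2 * x * mul_inv_cancel₀ aSer_ne_zero + qSer * aSer⁻¹ * w * mul_inv_cancel₀ qSer_ne_zero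
  -- Both crossings between the last two strands are removed by destabilization, and the smoothing
  -- leaves a split circle.
  · have h := homfly_skein (Braid.addStrand k β) (Fin.last k)
    have h1 := stab k β
    have h2 := stabInv k β
    rw [homflySer] at h1 h2
    rw [h1, h2] at h
    rw [smul_def, coe_dSer]
    rw [div_mul_eq_mul_div, eq_div_iff qSer_sub_inv_ne_zero, mul_comm, homflySer, ← h]
    ring

/-! ### Closed forms of the limit -/

theorem substNegOne_term (x : FieldA) (i j : ℕ) :
    (substNegOne (PowerSeries.C (Polynomial.C x * Polynomial.X ^ i) * PowerSeries.X ^ j) :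
      SeriesAQ) = HahnSeries.C x * (-1) ^ i * qSer ^ j := by
  simp [substNegOne, HahnSeries.ofPowerSeries_C, HahnSeries.ofPowerSeries_X]

/-- At `t = -1` the even exponents `2j - 2` in the denominator give `1`, and the odd exponents `2j +
1` in the numerator give `-1`. -/
theorem coe_substNegOne_stableSuperpolynomial (k : ℕ) :
    (substNegOne (stableSuperpolynomial (k + 1)) : SeriesAQ) =
      ∏ j ∈ Finset.range k,
        (1 - aSer ^ 2 * qSer ^ (2 * (j + 1))) / (1 - qSer ^ (2 * (j + 2))) := by
  set ψ : PowerSeries (Polynomial FieldA) →+* SeriesAQ :=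
    (HahnSeries.ofPowerSeries ℤ FieldA).comp substNegOne
  have hψ : ∀ x i j, ψ (PowerSeries.C (Polynomial.C x * Polynomial.X ^ i) * PowerSeries.X ^ j) =
    HahnSeries.C x * (-1) ^ i * qSer ^ j := substNegOne_term
  change ψ (stableSuperpolynomial (k + 1)) = _
  have hden : ψ (∏ j ∈ Finset.Icc 2 (k + 1),
      (1 - PowerSeries.C (Polynomial.X ^ (2 * j - 2)) * PowerSeries.X ^ (2 * j))) =
      ∏ j ∈ Finset.range k, (1 - qSer ^ (2 * (j + 2))) := by
    rw [map_prod, Finset.range_eq_Ico, Finset.prod_Ico_add' (fun j => 1 - qSer ^ (2 * j)) 0 k 2]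
    refine Finset.prod_congr (by ext; simp only [Finset.mem_Ico, Finset.mem_Icc]; omega) fun j hj => ?_
    have := hψ 1 (2 * j - 2) (2 * j)
    rw [map_one, one_mul, map_one, one_mul, Even.neg_one_pow (by
      obtain ⟨h, -⟩ := Finset.mem_Icc.mp hj
      exact ⟨j - 1, by omega⟩), one_mul] at this
    rw [map_sub, map_one, this]
  have hnum : ψ (∏ j ∈ Finset.Icc 1 (k + 1 - 1),
      (1 + PowerSeries.C (Polynomial.C (RatFunc.X ^ 2) * Polynomial.X ^ (2 * j + 1)) *
        PowerSeries.X ^ (2 * j))) =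
      ∏ j ∈ Finset.range k, (1 - aSer ^ 2 * qSer ^ (2 * (j + 1))) := by
    rw [map_prod, Finset.range_eq_Ico,
      Finset.prod_Ico_add' (fun j => 1 - aSer ^ 2 * qSer ^ (2 * j)) 0 k 1]
    refine Finset.prod_congr (by ext; simp only [Finset.mem_Ico, Finset.mem_Icc]; omega) fun j hj => ?_
    rw [map_add, map_one, hψ, Odd.neg_one_pow ⟨j, rfl⟩, map_pow]
    ring
  have hinv := congrArg ψ (PowerSeries.invOfUnit_mul (∏ j ∈ Finset.Icc 2 (k + 1),
      (1 - PowerSeries.C (Polynomial.X ^ (2 * j - 2) : Polynomial FieldA) *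
        PowerSeries.X ^ (2 * j))) 1 (by
      rw [map_prod, Units.val_one]
      refine Finset.prod_eq_one fun j hj => ?_
      have : 2 * j ≠ 0 := by have := (Finset.mem_Icc.mp hj).1; omega
      simp [this]))
  rw [map_mul, map_one, hden] at hinv
  rw [stableSuperpolynomial, map_mul, hnum, eq_inv_of_mul_eq_one_left hinv,
    Finset.prod_div_distrib, div_eq_mul_inv]

/-- The prefactor shifts the denominators from `j = 1, …, k` to `j = 2, …, k + 1`. -/
theorem coe_product_formula (k : ℕ) :
    (((1 - qVar ^ 2) / (1 - qVar ^ (2 * (k + 1))) *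
        ∏ j ∈ Finset.Icc 1 k,
          (1 - aVar ^ 2 * qVar ^ (2 * j)) / (1 - qVar ^ (2 * j)) : FieldAQ) : SeriesAQ) =
      ∏ j ∈ Finset.range k,
        (1 - aSer ^ 2 * qSer ^ (2 * (j + 1))) / (1 - qSer ^ (2 * (j + 2))) := by
  simp only [map_mul, map_div₀, map_prod, map_sub, map_one, map_pow, coe_qVar, coe_aVar]
  induction k with
  | zero => simpa using div_self (one_sub_qSer_pow_ne_zero two_ne_zero)
  | succ k ih =>
    rw [Finset.prod_range_succ, ← ih, Finset.prod_Icc_succ_top (by omega)]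
    have h1 := one_sub_qSer_pow_ne_zero (j := 2 * (k + 1)) (by omega)
    have h2 := one_sub_qSer_pow_ne_zero (j := 2 * (k + 2)) (by omega)
    rw [show k + 1 + 1 = k + 2 from rfl]
    generalize (∏ j ∈ Finset.Icc 1 k, _ : SeriesAQ) = p
    field_simp

/-! ### Torus links -/

/-- The factor contributed by one strand to the trace of the symmetrizer, for `y = q ^ (2 (j + 1))`
and `z = 1 - q ^ (2 (j + 2))`. Over the denominator `1 - q ^ 2` the terms `± y q a⁻¹` cancel. -/
theorem splitting_factor {K : Type*} [Field K] {a q y z : K} (ha : a ≠ 0) (hq : q ≠ 0)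
    (h1 : 1 - q ^ 2 ≠ 0) (h2 : q - q⁻¹ ≠ 0) (hz : z ≠ 0) :
    (z / (1 - q ^ 2))⁻¹ * (y * ((a - a⁻¹) / (q - q⁻¹)) + (1 - y) / (1 - q ^ 2) * (q * a⁻¹)) =
      q * a⁻¹ * ((1 - a ^ 2 * y) / z) := by
  have e : (a - a⁻¹) / (q - q⁻¹) = q * (a⁻¹ - a) / (1 - q ^ 2) := by
    rw [div_eq_div_iff h2 h1]
    field_simp
    ring
  rw [e]
  field_simp
  ring

theorem tendsto_torusLink (k : ℕ) :
    Tendsto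
      (fun m : ℕ =>
        (((qVar * aVar⁻¹) ^ (((m : ℤ) - 1) * (((k + 1 : ℕ) : ℤ) - 1)) *
          homfly (torusLink m (k + 1)) : FieldAQ) : SeriesAQ)) atTop
      (𝓝 (∏ j ∈ Finset.range k,
        (1 - aSer ^ 2 * qSer ^ (2 * (j + 1))) / (1 - qSer ^ (2 * (j + 2))))) := by
  have ha := aSer_ne_zero
  have hq := qSer_ne_zero
  have hb : qSer * aSer⁻¹ ≠ 0 := mul_ne_zero hq (inv_ne_zero ha)
  have hconst : ∀ j, PowerSeries.constantCoeff
      (∑ i ∈ Finset.range (j + 1), (PowerSeries.X ^ 2 : PowerSeries FieldA) ^ i) ≠ 0 := by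
    intro j
    rw [Finset.sum_range_succ', map_add, map_sum, Finset.sum_eq_zero (by simp)]
    simp
  have hgeom : ∀ j, ((∑ i ∈ Finset.range j,
      (PowerSeries.X ^ 2 : PowerSeries FieldA) ^ i : PowerSeries FieldA) : SeriesAQ) =
      (1 - qSer ^ (2 * j)) / (1 - qSer ^ 2) := by
    intro j
    rw [eq_div_iff (one_sub_qSer_pow_ne_zero two_ne_zero), map_sum]
    simp only [map_pow, HahnSeries.ofPowerSeries_X]
    rw [pow_mul, geom_sum_mul_neg]
  let r : ℕ → PowerSeries FieldA := fun j => (∑ i ∈ Finset.range (j + 1), (PowerSeries.X ^ 2) ^ i)⁻¹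
  have hr : ∀ j, r j * ∑ i ∈ Finset.range (j + 1), (PowerSeries.X ^ 2) ^ i = 1 := fun j =>
    PowerSeries.inv_mul_cancel _ (hconst j)
  have hfac : ∀ j, ((r (j + 1) * ((PowerSeries.X ^ 2) ^ (j + 1) * dSer +
      (∑ i ∈ Finset.range (j + 1), (PowerSeries.X ^ 2) ^ i) * cSer) : PowerSeries FieldA) :
        SeriesAQ) = qSer * aSer⁻¹ *
        ((1 - aSer ^ 2 * qSer ^ (2 * (j + 1))) / (1 - qSer ^ (2 * (j + 2)))) := by
    intro j
    simp only [r]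
    rw [map_mul, coe_inv_powerSeries (hconst _), hgeom, map_add, map_mul, map_mul, hgeom, coe_cSer,
      coe_dSer, map_pow, map_pow, HahnSeries.ofPowerSeries_X, ← pow_mul]
    exact splitting_factor ha hq (one_sub_qSer_pow_ne_zero two_ne_zero) qSer_sub_inv_ne_zero
      (one_sub_qSer_pow_ne_zero (by omega))
  set G := ∏ j ∈ Finset.range k,
    (1 - aSer ^ 2 * qSer ^ (2 * (j + 1))) / (1 - qSer ^ (2 * (j + 2)))
  -- The exponent `(m - 1) k` is `k m - k`: the part `k m` normalizes the `k m` negative crossings,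
  -- and `-k` is a constant factor.
  have hu : ∀ m : ℕ, (((qVar * aVar⁻¹) ^ (((m : ℤ) - 1) * (((k + 1 : ℕ) : ℤ) - 1)) *
      homfly (torusLink m (k + 1)) : FieldAQ) : SeriesAQ) =
      ((qSer * aSer⁻¹) ^ k)⁻¹ * (cSer ^ (k * m) •
        homflySer k ((List.ofFn fun i : Fin k => (Braid.σ i)⁻¹).prod ^ m)) := by
    intro m
    rw [Algebra.smul_def, ← mul_assoc, map_pow, LaurentSeries.coe_algebraMap, coe_cSer, map_mul,
      map_zpow₀, map_mul, map_inv₀, coe_qVar, coe_aVar]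
    congr 1
    rw [← zpow_natCast, ← zpow_natCast, ← zpow_neg, ← zpow_add₀ hb]
    congr 1
    push_cast
    ring
  have hunknot : homflySer 0 1 = 1 := by
    have := congrArg (fun x : FieldAQ => (x : SeriesAQ)) isHOMFLY_homfly.1
    exact this.trans (map_one _)
  have herr : Tendsto (fun m : ℕ => cSer ^ (k * m) •
      homflySer k ((List.ofFn fun i : Fin k => (Braid.σ i)⁻¹).prod ^ m) -
        (qSer * aSer⁻¹) ^ k * G) atTop (𝓝 0) := by
    refine LaurentSeries.tendsto_zero_of_X_pow_dvd fun l => ?_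
    filter_upwards [eventually_ge_atTop ((k + 1) * (l + 1))] with m hm
    obtain ⟨s, hs⟩ := isMarkov_homflySer.exists_trace_coxeter_pow hr hm
    -- The error is divisible by `Q ^ l = X ^ (2 l)`, so a factor `X ^ l` is left over.
    refine ⟨PowerSeries.X ^ l * s, ?_⟩
    rw [hs, hunknot, Algebra.smul_def, Algebra.smul_def, mul_one, mul_one,
      LaurentSeries.coe_algebraMap, map_prod, Finset.prod_congr rfl fun j _ => hfac j,
      Finset.prod_mul_distrib, Finset.prod_const, Finset.card_range, add_sub_cancel_left]
    congr 1
    ring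
  have h := (herr.add_const ((qSer * aSer⁻¹) ^ k * G)).const_mul ((qSer * aSer⁻¹) ^ k)⁻¹
  rw [zero_add, inv_mul_cancel_left₀ (pow_ne_zero k hb)] at h
  simpa only [hu, sub_add_cancel] using h

theorem mainTheorem1 (n : ℕ) (hn : 1 ≤ n) :
    Tendsto
      (fun m : ℕ =>
        (((qVar * aVar⁻¹) ^ (((m : ℤ) - 1) * ((n : ℤ) - 1)) * homfly (torusLink m n) : FieldAQ) :
          SeriesAQ))
      (atTop ⊓ 𝓟 {m : ℕ | m.Coprime n})
      (𝓝 (substNegOne (stableSuperpolynomial n) : SeriesAQ)) ∧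
    (substNegOne (stableSuperpolynomial n) : SeriesAQ) =
      (((1 - qVar ^ 2) / (1 - qVar ^ (2 * n)) *
        ∏ j ∈ Finset.Icc 1 (n - 1),
          (1 - aVar ^ 2 * qVar ^ (2 * j)) / (1 - qVar ^ (2 * j)) : FieldAQ) : SeriesAQ) := by
  obtain ⟨k, rfl⟩ : ∃ k, n = k + 1 := ⟨n - 1, by omega⟩
  rw [Nat.add_sub_cancel, coe_product_formula, coe_substNegOne_stableSuperpolynomial]
  exact ⟨(tendsto_torusLink k).mono_left inf_le_left, rfl⟩
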